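/- For an integer $k \geq 1$, let $X^k(\mathbb{R})$ be the set of functions $u \in L^1_{\rm loc}(\mathbb{R}, \mathbb{C})$ such that $1 - |u|^2 \in L^2(\mathbb{R})$ and $\partial_x u \in H^{k-1}(\mathbb{R})$, endowed, for some fixed $A > 0$, with the distance $$d(u, v) = \|u - v\|_{L^\infty([-A, A])} + \|\partial_x u - \partial_x v\|_{H^{k-1}(\mathbb{R})} + \big\| |u| - |v| \big\|_{L^2(\mathbb{R})}.$$ Let $E(u) = \frac12 \int_{\mathbb{R}} |\partial_x u|^2 + \frac14 \int_{\mathbb{R}} (1 - |u|^2)^2$, and for $f \in L^1_{\rm loc}(\mathbb{R})$ let $$\|f\|_{\mathcal{M}} = \sup_{(a,b) \in \mathbb{R}^2} \Big| \int_a^b f(x)\, dx \Big| \in [0, +\infty].$$ Let $0 \leq E_0 < \frac{2\sqrt2}{3}$. There is a constant $K > 0$, depending only on $E_0$, with the following property. Let $\Psi \in \mathcal{C}^0(\mathbb{R}, X^4(\mathbb{R}))$ be a solution on $\mathbb{R} \times \mathbb{R}$, in the sense of distributions, of the Gross-Pitaevskii equation $$i \partial_t \Psi + \partial_x^2 \Psi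 = \Psi (|\Psi|^2 - 1),$$ with $E(\Psi(\cdot, 0)) \leq E_0$. Set $\eta = 1 - |\Psi|^2$ and write $\Psi(\cdot, t) = |\Psi(\cdot, t)| \exp(i \varphi(\cdot, t))$, where $\varphi(\cdot, t)$ is real-valued and continuous for each $t$. Then, for every $t \in \mathbb{R}$, the integral below is finite and $$\|\eta(\cdot, t)\|_{\mathcal{M}} + \sqrt2\, \|\partial_x \varphi(\cdot, t)\|_{\mathcal{M}} \leq K \bigg( \|\eta(\cdot, 0)\|_{\mathcal{M}} + \sqrt2\, \|\partial_x \varphi(\cdot, 0)\|_{\mathcal{M}} + \bigg| \int_0^t \Big( \|\partial_x^2 \eta(\cdot, s)\|_{L^\infty} + \|\eta(\cdot, s)\|_{W^{2,\infty}}^2 + \|\partial_x \varphi(\cdot, s)\|_{L^\infty}^2 \Big) ds \bigg| \bigg).$$ In particular, if the two $\mathcal{M}$-norms are finite at time $0$, then they are finite at every time. -/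

import Mathlib

open MeasureTheory Filter Topology
open scoped ENNReal NNReal ContDiff

namespace GrossPitaevskii

noncomputable section

/-- `g` is the weak derivative of `f` on the real line (both locally integrable). -/
def HasWeakDeriv (f g : ℝ → ℂ) : Prop :=
  LocallyIntegrable f volume ∧ LocallyIntegrable g volume ∧
    ∀ θ : ℝ → ℝ, ContDiff ℝ ∞ θ → HasCompactSupport θ →
      ∫ x, deriv θ x • f x = -∫ x, θ x • g x

open Classical in
/-- A weak derivative of `f` (unique up to a null set), and `0` if there is none. -/
def weakDeriv (f : ℝ → ℂ) : ℝ → ℂ :=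
  if h : ∃ g, HasWeakDeriv f g then h.choose else 0

/-- The Sobolev space `H^m(ℝ, ℂ)`. -/
def MemH (m : ℕ) (f : ℝ → ℂ) : Prop :=
  (∀ j < m, HasWeakDeriv (weakDeriv^[j] f) (weakDeriv^[j + 1] f)) ∧
    ∀ j ≤ m, MemLp (weakDeriv^[j] f) 2 volume

/-- The norm of `H^m(ℝ, ℂ)`. -/
def normH (m : ℕ) (f : ℝ → ℂ) : ℝ≥0∞ :=
  (∑ j ∈ Finset.range (m + 1), eLpNorm (weakDeriv^[j] f) 2 volume ^ 2) ^ (1 / 2 : ℝ)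

/-- The space `X^k(ℝ)`, for `k ≥ 1`: locally integrable `u` with `1 - |u|² ∈ L²` and
`∂ₓu ∈ H^{k-1}`. -/
def MemX (k : ℕ) (u : ℝ → ℂ) : Prop :=
  LocallyIntegrable u volume ∧ MemLp (fun x => 1 - ‖u x‖ ^ 2) 2 volume ∧
    HasWeakDeriv u (weakDeriv u) ∧ MemH (k - 1) (weakDeriv u)

/-- The distance `d_{X^k, A}` on `X^k(ℝ)`, for `k ≥ 1` and `A > 0`. -/
def distX (k : ℕ) (A : ℝ) (u v : ℝ → ℂ) : ℝ≥0∞ :=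
  eLpNorm (fun x => u x - v x) ∞ (volume.restrict (Set.Icc (-A) A)) +
    normH (k - 1) (fun x => weakDeriv u x - weakDeriv v x) +
    eLpNorm (fun x => ‖u x‖ - ‖v x‖) 2 volume

/-- `Ψ ∈ C⁰(ℝ, X^k(ℝ))`, where `Ψ t` is the function `Ψ(·, t)`. As usual for functions in `X^k(ℝ)`,
`Ψ t` stands for the continuous representative of its class. -/
def MemC0X (k : ℕ) (A : ℝ) (Ψ : ℝ → ℝ → ℂ) : Prop :=
  (∀ t, Continuous (Ψ t)) ∧ (∀ t, MemX k (Ψ t)) ∧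
    ∀ t, Tendsto (fun s => distX k A (Ψ s) (Ψ t)) (𝓝 t) (𝓝 0)

/-- `Ψ` solves `i ∂ₜΨ + ∂ₓ²Ψ = Ψ (|Ψ|² - 1)` in the sense of distributions on `ℝ × ℝ`. Points of
`ℝ × ℝ` are written `(t, x)`. -/
def SolvesGP (Ψ : ℝ → ℝ → ℂ) : Prop :=
  ∀ θ : ℝ × ℝ → ℝ, ContDiff ℝ ∞ θ → HasCompactSupport θ →
    ∫ p : ℝ × ℝ,
        (-(Complex.I * ((deriv (fun s => θ (s, p.2)) p.1 : ℝ) : ℂ)) +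
          ((iteratedDeriv 2 (fun y => θ (p.1, y)) p.2 : ℝ) : ℂ)) * Ψ p.1 p.2 =
      ∫ p : ℝ × ℝ, (θ p : ℂ) * (Ψ p.1 p.2 * ((‖Ψ p.1 p.2‖ : ℂ) ^ 2 - 1))

/-- The Ginzburg-Landau energy. -/
def energy (u : ℝ → ℂ) : ℝ :=
  (1 / 2) * (∫ x, ‖weakDeriv u x‖ ^ 2) + (1 / 4) * ∫ x, (1 - ‖u x‖ ^ 2) ^ 2

/-- `φ` is a phase of `u`: it is continuous and `u = |u| exp (iφ)`. -/
def IsPhase (φ : ℝ → ℝ) (u : ℝ → ℂ) : Prop :=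
  Continuous φ ∧ ∀ x, u x = (‖u x‖ : ℂ) * Complex.exp (Complex.I * (φ x : ℂ))

/-- `η = 1 - |u|²`. -/
def eta (u : ℝ → ℂ) : ℝ → ℝ := fun x => 1 - ‖u x‖ ^ 2

/-- The norm of `𝓜(ℝ)`: the supremum over `(a, b) ∈ ℝ²` of `|∫_a^b f|`. -/
def normM (f : ℝ → ℝ) : ℝ≥0∞ :=
  ⨆ (a : ℝ) (b : ℝ), ‖∫ x in a..b, f x‖ₑ

/-- The norm of `L^∞(ℝ)`. -/
def normLinf (f : ℝ → ℝ) : ℝ≥0∞ := eLpNorm f ∞ volume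

/-- The norm of `W^{2,∞}(ℝ)`, for functions of class `C²`. -/
def normW2inf (f : ℝ → ℝ) : ℝ≥0∞ :=
  normLinf f + normLinf (deriv f) + normLinf (iteratedDeriv 2 f)

/-- `|∫_0^t (‖∂ₓ²η(s)‖_{L^∞} + ‖η(s)‖²_{W^{2,∞}} + ‖∂ₓφ(s)‖²_{L^∞}) ds|`. -/
def transportIntegral (Ψ : ℝ → ℝ → ℂ) (φ : ℝ → ℝ → ℝ) (t : ℝ) : ℝ≥0∞ :=
  ∫⁻ s in Set.uIcc 0 t,
    (normLinf (iteratedDeriv 2 (eta (Ψ s))) + normW2inf (eta (Ψ s)) ^ 2 +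
      normLinf (deriv (φ s)) ^ 2)

end

end GrossPitaevskii

open GrossPitaevskii

namespace GrossPitaevskii

/-! ### Weak derivatives on the line -/

/-! Write v = ∂ₓφ and η = 1 - |Ψ|². The hydrodynamic form of the equation is ∂ₜη = ∂ₓ(2(1 - η)v) and
∂ₜv = ∂ₓ(η + R), with R = ⟨Ψ, ∂ₓ²Ψ⟩/|Ψ|². For c = ±√2 the Riemann invariant w = η - cv therefore
satisfies ∂ₜw + c∂ₓw = ∂ₓ(-2ηv - cR): the linear terms cancel because c² = 2. Since R =
-∂ₓ²η/(2|Ψ|²) - |∂ₓΨ|²/|Ψ|², the remaining flux is bounded by |∂ₓ²η| + η² + (∂ₓη)² + v², as soon as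
|Ψ| is bounded from below (`IsJet.abs_flux_le`).

Integrated over an interval moving at speed c, this balance law has only two boundary terms
(`IsJetCurve.integral_riemann_sub`). Hence ∫ w over any interval at time t is an integral of w at
time 0, plus at most a constant times the transport integral. The sum and the difference of the two
invariants give back η and √2 v (`IsJetCurve.normM_le`).

The lower bound on |Ψ| comes from the energy. By a Modica-Mortola argument, reaching a zero from |u|
= 1 and returning costs at least 2√2/3 (`exists_lower_bound`), and the energy is conserved
(`IsJetCurve.energy_eq`). The solution is only distributional, so it has to be shown first that
curves in X⁴ have continuous space derivatives up to order three (`exists_isJetCurve`) and that the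
equation holds pointwise (`IsJetCurve.hasDerivAt_time`). -/

lemma intervalIntegrable_of_locallyIntegrable {E : Type*} [NormedAddCommGroup E] {g : ℝ → E}
    (hg : LocallyIntegrable g volume) (a b : ℝ) : IntervalIntegrable g volume a b :=
  (hg.integrableOn_isCompact isCompact_uIcc).intervalIntegrable

lemma integral_eq_intervalIntegral_of_support {E : Type*} [NormedAddCommGroup E] [NormedSpace ℝ E]
    {f : ℝ → E} {R : ℝ} (h : ∀ x, R ≤ |x| → f x = 0) :
    ∫ x, f x = ∫ x in (-R)..R, f x := by
  rcases le_or_gt 0 R with hR | hR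
  · rw [intervalIntegral.integral_eq_integral_of_support_subset]
    intro x hx
    by_contra hx'
    apply hx
    by_cases h1 : R ≤ |x|
    · exact h x h1
    · exact absurd (⟨(abs_lt.mp (not_le.mp h1)).1, (abs_lt.mp (not_le.mp h1)).2.le⟩) hx'
  · have : f = 0 := by
      ext x
      exact h x (hR.le.trans (abs_nonneg x))
    simp [this]

lemma exists_abs_bound_of_hasCompactSupport {θ : ℝ → ℝ} (h : HasCompactSupport θ) :
    ∃ R, 0 < R ∧ (∀ x, R ≤ |x| → θ x = 0) ∧ ∀ x, R ≤ |x| → deriv θ x = 0 := by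
  obtain ⟨R, hR⟩ := h.isCompact.isBounded.subset_closedBall 0
  have key : ∀ x, max R 0 + 1 ≤ |x| → x ∉ tsupport θ := by
    intro x hx hx'
    have := hR hx'
    rw [mem_closedBall_zero_iff, Real.norm_eq_abs] at this
    linarith [le_max_left R 0]
  refine ⟨max R 0 + 1, by positivity, fun x hx => image_eq_zero_of_notMem_tsupport (key x hx),
    fun x hx => ?_⟩
  exact image_eq_zero_of_notMem_tsupport (fun h' => key x hx (tsupport_deriv_subset h'))

/-- The primitive is only absolutely continuous, so integration by parts is used in its absolutely
continuous form. The boundary terms vanish because θ(±R) = 0. -/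
lemma integral_deriv_mul_primitive {g : ℝ → ℝ} (hg : LocallyIntegrable g volume) {θ : ℝ → ℝ}
    (hθ : ContDiff ℝ ∞ θ) (hc : HasCompactSupport θ) :
    ∫ x, deriv θ x * (∫ y in (0 : ℝ)..x, g y) = -∫ x, θ x * g x := by
  obtain ⟨R, hR, h0, h1⟩ := exists_abs_bound_of_hasCompactSupport hc
  rw [integral_eq_intervalIntegral_of_support (R := R) (fun x hx => by rw [h1 x hx, zero_mul]),
    integral_eq_intervalIntegral_of_support (R := R) (fun x hx => by rw [h0 x hx, zero_mul])]
  have hI : ∀ a b, IntervalIntegrable g volume a b := fun a b =>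
    intervalIntegrable_of_locallyIntegrable hg _ _
  have hG : AbsolutelyContinuousOnInterval (fun x => ∫ y in (0 : ℝ)..x, g y) (-R) R :=
    (hI _ _).absolutelyContinuousOnInterval_intervalIntegral (by
      rw [Set.uIcc_of_le (by linarith)]; constructor <;> linarith)
  have hT : AbsolutelyContinuousOnInterval θ (-R) R :=
    ContDiffOn.absolutelyContinuousOnInterval (hθ.of_le (by simp)).contDiffOn
  have := hT.integral_mul_deriv_eq_deriv_mul hG
  rw [h0 R (le_abs_self R), h0 (-R) (by rw [abs_neg]; exact le_abs_self R)] at this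
  have h2 : ∫ x in (-R)..R, θ x * deriv (fun x => ∫ y in (0 : ℝ)..x, g y) x
      = ∫ x in (-R)..R, θ x * g x := by
    apply intervalIntegral.integral_congr_ae
    filter_upwards [_root_.LocallyIntegrable.ae_hasDerivAt_integral hg] with x hx _
    rw [(hx 0).deriv]
  rw [← h2, this]
  simp

lemma integrable_smul_of_locallyIntegrable {f : ℝ → ℂ} (hf : LocallyIntegrable f volume)
    {θ : ℝ → ℝ} (hθ : Continuous θ) (hc : HasCompactSupport θ) :
    Integrable (fun x => θ x • f x) volume :=
  hf.integrable_smul_left_of_hasCompactSupport hθ hc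

lemma continuous_primitive {E : Type*} [NormedAddCommGroup E] [NormedSpace ℝ E]
    {g : ℝ → E} (hg : LocallyIntegrable g volume) :
    Continuous (fun x => ∫ y in (0 : ℝ)..x, g y) :=
  intervalIntegral.continuous_primitive (fun _ _ => intervalIntegrable_of_locallyIntegrable hg _ _) 0

lemma hasWeakDeriv_primitive {g : ℝ → ℂ} (hg : LocallyIntegrable g volume) :
    HasWeakDeriv (fun x => ∫ y in (0 : ℝ)..x, g y) g := by
  have hG := continuous_primitive hg
  refine ⟨hG.locallyIntegrable, hg, fun θ hθ hc => ?_⟩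
  have hI1 := integrable_smul_of_locallyIntegrable hG.locallyIntegrable
    (hθ.continuous_deriv (by simp)) hc.deriv
  have hI2 := integrable_smul_of_locallyIntegrable hg hθ.continuous hc
  have hII : ∀ x, IntervalIntegrable g volume 0 x := fun x =>
    intervalIntegrable_of_locallyIntegrable hg _ _
  -- Real functionals commute with all the integrals; real and imaginary parts reduce the claim to
  -- the real-valued case.
  have hL : ∀ L : ℂ →L[ℝ] ℝ, L (∫ x, deriv θ x • ∫ y in (0 : ℝ)..x, g y)
      = L (-∫ x, θ x • g x) := by
    intro L
    rw [map_neg, ← L.integral_comp_comm hI1, ← L.integral_comp_comm hI2]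
    have hLg : LocallyIntegrable (fun x => L (g x)) volume := by
      intro x
      obtain ⟨s, hs, h⟩ := hg x
      exact ⟨s, hs, L.integrable_comp h⟩
    have := integral_deriv_mul_primitive hLg hθ hc
    simp only [map_smul, smul_eq_mul]
    rw [← this]
    congr 1
    ext x
    rw [L.intervalIntegral_comp_comm (hII x)]
  apply Complex.ext
  · exact hL Complex.reCLM
  · exact hL Complex.imCLM

lemma HasWeakDeriv.sub {f g f' g' : ℝ → ℂ} (h : HasWeakDeriv f g) (h' : HasWeakDeriv f' g') :
    HasWeakDeriv (fun x => f x - f' x) (fun x => g x - g' x) := by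
  refine ⟨h.1.sub h'.1, h.2.1.sub h'.2.1, fun θ hθ hc => ?_⟩
  simp only [smul_sub]
  have hd : Continuous (deriv θ) := hθ.continuous_deriv (by simp)
  rw [integral_sub (integrable_smul_of_locallyIntegrable h.1 hd hc.deriv)
    (integrable_smul_of_locallyIntegrable h'.1 hd hc.deriv),
    integral_sub (integrable_smul_of_locallyIntegrable h.2.1 hθ.continuous hc)
    (integrable_smul_of_locallyIntegrable h'.2.1 hθ.continuous hc), h.2.2 θ hθ hc,
    h'.2.2 θ hθ hc]
  ring

lemma locallyIntegrable_congr {f f' : ℝ → ℂ} (hf : f =ᵐ[volume] f')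
    (h : LocallyIntegrable f volume) : LocallyIntegrable f' volume := by
  intro x
  obtain ⟨s, hs, hi⟩ := h x
  exact ⟨s, hs, hi.congr (ae_restrict_of_ae hf)⟩

lemma HasWeakDeriv.congr {f g f' g' : ℝ → ℂ} (h : HasWeakDeriv f g) (hf : f =ᵐ[volume] f')
    (hg : g =ᵐ[volume] g') : HasWeakDeriv f' g' := by
  refine ⟨locallyIntegrable_congr hf h.1, locallyIntegrable_congr hg h.2.1, fun θ hθ hc => ?_⟩
  have h1 : ∫ x, deriv θ x • f' x = ∫ x, deriv θ x • f x := by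
    apply integral_congr_ae
    filter_upwards [hf] with x hx
    rw [hx]
  have h2 : ∫ x, θ x • g' x = ∫ x, θ x • g x := by
    apply integral_congr_ae
    filter_upwards [hg] with x hx
    rw [hx]
  rw [h1, h2, h.2.2 θ hθ hc]

lemma HasWeakDeriv.unique {f g g' : ℝ → ℂ} (h : HasWeakDeriv f g) (h' : HasWeakDeriv f g') :
    g =ᵐ[volume] g' := by
  apply ae_eq_of_integral_contDiff_smul_eq h.2.1 h'.2.1
  intro θ hθ hc
  have h1 := h.2.2 θ hθ hc
  rw [h'.2.2 θ hθ hc] at h1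
  exact (neg_injective h1).symm

/-- `weakDeriv` is an arbitrary choice; uniqueness up to null sets is what makes it computable. -/
lemma HasWeakDeriv.weakDeriv_ae_eq {f g : ℝ → ℂ} (h : HasWeakDeriv f g) :
    weakDeriv f =ᵐ[volume] g := by
  have hex : ∃ g, HasWeakDeriv f g := ⟨g, h⟩
  have : HasWeakDeriv f (weakDeriv f) := by
    rw [weakDeriv, dif_pos hex]
    exact hex.choose_spec
  exact this.unique h

/-- A smooth compactly supported function of integral zero is the derivative of such a function. -/
lemma exists_contDiff_deriv_eq {ψ : ℝ → ℝ} (hψ : ContDiff ℝ ∞ ψ) (hc : HasCompactSupport ψ)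
    (h0 : ∫ x, ψ x = 0) : ∃ θ : ℝ → ℝ, ContDiff ℝ ∞ θ ∧ HasCompactSupport θ ∧ deriv θ = ψ := by
  obtain ⟨R, hR, hz, -⟩ := exists_abs_bound_of_hasCompactSupport hc
  have hd : ∀ x, HasDerivAt (fun x => ∫ y in (-R)..x, ψ y) (ψ x) x := fun x =>
    intervalIntegral.integral_hasDerivAt_right (hψ.continuous.intervalIntegrable _ _)
      hψ.continuous.stronglyMeasurable.stronglyMeasurableAtFilter hψ.continuous.continuousAt
  have hderiv : deriv (fun x => ∫ y in (-R)..x, ψ y) = ψ := funext fun x => (hd x).deriv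
  refine ⟨fun x => ∫ y in (-R)..x, ψ y, ?_, ?_, hderiv⟩
  · rw [contDiff_infty_iff_deriv]
    exact ⟨fun x => (hd x).differentiableAt, by rw [hderiv]; exact hψ⟩
  · apply HasCompactSupport.of_support_subset_isCompact (isCompact_Icc (a := -R) (b := R))
    intro x hx
    by_contra hx'
    apply hx
    rw [Set.mem_Icc, not_and_or, not_le, not_le] at hx'
    rcases hx' with h | h
    · show ∫ y in (-R)..x, ψ y = 0
      apply intervalIntegral.integral_zero_ae
      refine Eventually.of_forall fun y hy => hz y ?_
      rw [Set.uIoc_of_ge h.le] at hy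
      rw [le_abs]
      right
      linarith [hy.2]
    · show ∫ y in (-R)..x, ψ y = 0
      rw [← h0, integral_eq_intervalIntegral_of_support hz]
      have := intervalIntegral.integral_add_adjacent_intervals
        (hψ.continuous.intervalIntegrable (μ := volume) (-R) R)
        (hψ.continuous.intervalIntegrable (μ := volume) R x)
      rw [← this, add_eq_left]
      apply intervalIntegral.integral_zero_ae
      refine Eventually.of_forall fun y hy => hz y ?_
      rw [Set.uIoc_of_le h.le] at hy
      rw [le_abs]
      left
      linarith [hy.1]

lemma exists_contDiff_integral_eq_one :
    ∃ χ : ℝ → ℝ, ContDiff ℝ ∞ χ ∧ HasCompactSupport χ ∧ ∫ x, χ x = 1 := by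
  let b : ContDiffBump (0 : ℝ) := ⟨1, 2, one_pos, one_lt_two⟩
  exact ⟨b.normed volume, b.contDiff_normed, b.hasCompactSupport_normed, b.integral_normed⟩

/-- The lemma of du Bois-Reymond. -/
lemma ae_eq_const_of_integral_deriv_smul_eq_zero {f : ℝ → ℂ} (hf : LocallyIntegrable f volume)
    (h : ∀ θ : ℝ → ℝ, ContDiff ℝ ∞ θ → HasCompactSupport θ → ∫ x, deriv θ x • f x = 0) :
    ∃ c : ℂ, f =ᵐ[volume] fun _ => c := by
  obtain ⟨χ, hχ, hχc, hχ1⟩ := exists_contDiff_integral_eq_one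
  refine ⟨∫ x, χ x • f x, ?_⟩
  apply ae_eq_of_integral_contDiff_smul_eq hf continuous_const.locallyIntegrable
  intro ψ hψ hψc
  have hχi : Integrable χ volume := hχ.continuous.integrable_of_hasCompactSupport hχc
  have hψi : Integrable ψ volume := hψ.continuous.integrable_of_hasCompactSupport hψc
  -- Subtracting (∫ψ)χ makes the integral zero, so the difference is the derivative of a test
  -- function, and f pairs with ψ as with (∫ψ)χ.
  have hc2 : HasCompactSupport (fun x => ψ x - (∫ y, ψ y) * χ x) :=
    hψc.sub (hχc.mul_left (f := fun _ => ∫ y, ψ y))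
  obtain ⟨θ, hθ, hθc, hθd⟩ := exists_contDiff_deriv_eq
    (ψ := fun x => ψ x - (∫ y, ψ y) * χ x) (hψ.sub (contDiff_const.mul hχ)) hc2
    (by rw [integral_sub hψi (hχi.const_mul _), integral_const_mul, hχ1]; ring)
  have h3 := h θ hθ hθc
  rw [hθd] at h3
  simp only [sub_smul, mul_smul] at h3
  rw [integral_sub (integrable_smul_of_locallyIntegrable hf hψ.continuous hψc)
    (by exact (integrable_smul_of_locallyIntegrable hf hχ.continuous hχc).smul (∫ y, ψ y)),
    integral_smul, sub_eq_zero] at h3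
  rw [h3, integral_smul_const]

theorem HasWeakDeriv.exists_ae_eq_primitive {f g : ℝ → ℂ} (h : HasWeakDeriv f g) :
    ∃ c : ℂ, f =ᵐ[volume] fun x => c + ∫ y in (0 : ℝ)..x, g y := by
  have h1 := h.sub (hasWeakDeriv_primitive h.2.1)
  obtain ⟨c, hc⟩ := ae_eq_const_of_integral_deriv_smul_eq_zero h1.1 (fun θ hθ hθc => by
    rw [h1.2.2 θ hθ hθc]; simp)
  refine ⟨c, ?_⟩
  filter_upwards [hc] with x hx
  rw [← hx]
  ring

/-- The fundamental theorem of calculus for the continuous representative. -/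
lemma HasWeakDeriv.sub_eq_integral {f g F : ℝ → ℂ} (h : HasWeakDeriv f g) (hF : Continuous F)
    (hfF : F =ᵐ[volume] f) (x y : ℝ) : F y - F x = ∫ z in x..y, g z := by
  obtain ⟨c, hc⟩ := h.exists_ae_eq_primitive
  have heq : F = fun x => c + ∫ y in (0 : ℝ)..x, g y :=
    (hF.ae_eq_iff_eq volume (continuous_const.add (continuous_primitive h.2.1))).1
      (hfF.trans hc)
  rw [heq]
  simp only [add_sub_add_left_eq_sub]
  exact intervalIntegral.integral_interval_sub_left
    (intervalIntegrable_of_locallyIntegrable h.2.1 _ _)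
    (intervalIntegrable_of_locallyIntegrable h.2.1 _ _)

lemma HasWeakDeriv.exists_continuous {f g : ℝ → ℂ} (h : HasWeakDeriv f g) :
    ∃ F : ℝ → ℂ, Continuous F ∧ F =ᵐ[volume] f := by
  obtain ⟨c, hc⟩ := h.exists_ae_eq_primitive
  exact ⟨_, continuous_const.add (continuous_primitive h.2.1), hc.symm⟩

lemma HasWeakDeriv.hasDerivAt {f g F G : ℝ → ℂ} (h : HasWeakDeriv f g) (hF : Continuous F)
    (hfF : F =ᵐ[volume] f) (hG : Continuous G) (hgG : G =ᵐ[volume] g) (x : ℝ) :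
    HasDerivAt F (G x) x := by
  have heq : F = fun y => F 0 + ∫ z in (0 : ℝ)..y, G z := by
    ext y
    have h1 := h.sub_eq_integral hF hfF 0 y
    have h2 : ∫ z in (0 : ℝ)..y, G z = ∫ z in (0 : ℝ)..y, g z :=
      intervalIntegral.integral_congr_ae (hgG.mono fun z hz _ => hz)
    rw [h2, ← h1]
    ring
  rw [heq]
  exact (intervalIntegral.integral_hasDerivAt_right (hG.intervalIntegrable _ _)
      hG.stronglyMeasurable.stronglyMeasurableAtFilter hG.continuousAt).const_add _

/-- The Sobolev embedding of `H¹` into the bounded functions. -/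
lemma HasWeakDeriv.enorm_le {f g F : ℝ → ℂ} (h : HasWeakDeriv f g) (hF : Continuous F)
    (hfF : F =ᵐ[volume] f) (x : ℝ) :
    ‖F x‖ₑ ≤ eLpNorm f 2 volume + eLpNorm g 2 volume := by
  -- On an interval of length one L¹ norms are bounded by L² norms. The estimate is |F(x)| ≤ |F(y)|
  -- + ∫|g|, averaged over y in this interval.
  let μ : Measure ℝ := volume.restrict (Set.Ioc x (x + 1))
  have hμ : IsProbabilityMeasure μ := ⟨by simp [μ]⟩
  have hgm : AEStronglyMeasurable g μ := h.2.1.aestronglyMeasurable.restrict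
  have h1 : eLpNorm g 1 μ ≤ eLpNorm g 2 volume :=
    (eLpNorm_le_eLpNorm_of_exponent_le (by norm_num) hgm).trans
      (eLpNorm_mono_measure _ Measure.restrict_le_self)
  have h2 : eLpNorm F 1 μ ≤ eLpNorm f 2 volume :=
    (eLpNorm_le_eLpNorm_of_exponent_le (by norm_num) hF.aestronglyMeasurable).trans
      ((eLpNorm_mono_measure _ Measure.restrict_le_self).trans (eLpNorm_congr_ae hfF).le)
  have h3 : ∀ y ∈ Set.Ioc x (x + 1), ‖F x‖ₑ ≤ ‖F y‖ₑ + eLpNorm g 1 μ := by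
    intro y hy
    have h4 : F x = F y - ∫ z in x..y, g z := by
      rw [← h.sub_eq_integral hF hfF x y]; ring
    rw [h4]
    refine (enorm_sub_le).trans (add_le_add le_rfl ?_)
    rw [intervalIntegral.integral_of_le hy.1.le, eLpNorm_one_eq_lintegral_enorm]
    refine (enorm_integral_le_lintegral_enorm _).trans ?_
    exact lintegral_mono_set (Set.Ioc_subset_Ioc_right hy.2)
  have h5 : ∫⁻ _, ‖F x‖ₑ ∂μ ≤ ∫⁻ y, (‖F y‖ₑ + eLpNorm g 1 μ) ∂μ :=
    setLIntegral_mono' measurableSet_Ioc h3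
  rw [lintegral_add_right _ measurable_const, lintegral_const, lintegral_const, measure_univ,
    mul_one, mul_one, ← eLpNorm_one_eq_lintegral_enorm] at h5
  exact h5.trans (add_le_add h2 h1)

/-! ### Regularity of the elements of `X⁴` -/

lemma HasWeakDeriv.exists_bound {f g F : ℝ → ℂ} (h : HasWeakDeriv f g) (hF : Continuous F)
    (hfF : F =ᵐ[volume] f) (hf : MemLp f 2 volume) (hg : MemLp g 2 volume) :
    ∃ M : ℝ, ∀ x, ‖F x‖ ≤ M := by
  refine ⟨(eLpNorm f 2 volume + eLpNorm g 2 volume).toReal, fun x => ?_⟩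
  have := ENNReal.toReal_mono (ENNReal.add_lt_top.2 ⟨hf.2, hg.2⟩).ne (h.enorm_le hF hfF x)
  rwa [toReal_enorm] at this

lemma eLpNorm_iterate_weakDeriv_le_normH {m j : ℕ} (hj : j ≤ m) (f : ℝ → ℂ) :
    eLpNorm (weakDeriv^[j] f) 2 volume ≤ normH m f := by
  have h1 : eLpNorm (weakDeriv^[j] f) 2 volume ^ 2 ≤
      ∑ j ∈ Finset.range (m + 1), eLpNorm (weakDeriv^[j] f) 2 volume ^ 2 :=
    Finset.single_le_sum (f := fun j => eLpNorm (weakDeriv^[j] f) 2 volume ^ 2)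
      (fun _ _ => zero_le) (Finset.mem_range.2 (by omega))
  calc eLpNorm (weakDeriv^[j] f) 2 volume
      = (eLpNorm (weakDeriv^[j] f) 2 volume ^ 2) ^ (1 / 2 : ℝ) := by
        rw [← ENNReal.rpow_natCast, ← ENNReal.rpow_mul]
        norm_num
    _ ≤ _ := ENNReal.rpow_le_rpow h1 (by norm_num)

/-- Being defined by choice, `weakDeriv` is linear only almost everywhere, and only where weak
derivatives exist. -/
lemma iterate_weakDeriv_sub_ae_eq {m : ℕ} {f g : ℝ → ℂ} (hf : MemH m f) (hg : MemH m g) {j : ℕ}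
    (hj : j ≤ m) : weakDeriv^[j] (fun x => f x - g x) =ᵐ[volume]
      fun x => weakDeriv^[j] f x - weakDeriv^[j] g x := by
  induction j with
  | zero => exact Eventually.of_forall fun _ => rfl
  | succ j ih =>
    rw [Function.iterate_succ_apply']
    exact (((hf.1 j (by omega)).sub (hg.1 j (by omega))).congr (ih (by omega)).symm
      (ae_eq_refl _)).weakDeriv_ae_eq

/-- Sobolev embedding applied to the difference; the factor 2 counts the derivatives of order j and
j + 1. It turns continuity in `distX` into uniform convergence of the space derivatives. -/
lemma enorm_sub_le_normH {m : ℕ} {f g : ℝ → ℂ} (hf : MemH m f) (hg : MemH m g) {j : ℕ}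
    (hj : j < m) {F G : ℝ → ℂ} (hF : Continuous F) (hG : Continuous G)
    (hFf : F =ᵐ[volume] weakDeriv^[j] f) (hGg : G =ᵐ[volume] weakDeriv^[j] g) (x : ℝ) :
    ‖F x - G x‖ₑ ≤ 2 * normH m (fun x => f x - g x) := by
  have h := ((hf.1 j hj).sub (hg.1 j hj)).enorm_le (F := fun x => F x - G x) (hF.sub hG)
    (by filter_upwards [hFf, hGg] with x h1 h2; rw [h1, h2]) x
  refine h.trans ?_
  rw [← eLpNorm_congr_ae (iterate_weakDeriv_sub_ae_eq hf hg hj.le),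
    ← eLpNorm_congr_ae (iterate_weakDeriv_sub_ae_eq hf hg (j := j + 1) hj), two_mul]
  exact add_le_add (eLpNorm_iterate_weakDeriv_le_normH hj.le _)
    (eLpNorm_iterate_weakDeriv_le_normH hj _)

/-- `p`, `q` and `r` are the first three derivatives of `u ∈ X⁴`. -/
structure IsJet (u p q r : ℝ → ℂ) : Prop where
  memX : MemX 4 u
  hasDerivAt_zero : ∀ x, HasDerivAt u (p x) x
  hasDerivAt_one : ∀ x, HasDerivAt p (q x) x
  hasDerivAt_two : ∀ x, HasDerivAt q (r x) x
  continuous_three : Continuous r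
  ae_eq_one : p =ᵐ[volume] weakDeriv u
  ae_eq_two : q =ᵐ[volume] weakDeriv^[1] (weakDeriv u)
  ae_eq_three : r =ᵐ[volume] weakDeriv^[2] (weakDeriv u)

/-- As ∂ₓu lies in H³, the weak derivatives of u of orders 1, 2 and 3 each have a weak derivative,
hence a continuous representative. -/
lemma exists_isJet {u : ℝ → ℂ} (hu : Continuous u) (h : MemX 4 u) :
    ∃ p q r, IsJet u p q r := by
  have hH : MemH 3 (weakDeriv u) := h.2.2.2
  obtain ⟨p, hp, hpe⟩ := (hH.1 0 (by norm_num)).exists_continuous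
  obtain ⟨q, hq, hqe⟩ := (hH.1 1 (by norm_num)).exists_continuous
  obtain ⟨r, hr, hre⟩ := (hH.1 2 (by norm_num)).exists_continuous
  exact ⟨p, q, r, h, h.2.2.1.hasDerivAt hu (ae_eq_refl _) hp hpe,
    (hH.1 0 (by norm_num)).hasDerivAt hp hpe hq hqe,
    (hH.1 1 (by norm_num)).hasDerivAt hq hqe hr hre, hr, hpe, hqe, hre⟩

namespace IsJet

variable {u p q r : ℝ → ℂ}

lemma memH (h : IsJet u p q r) : MemH 3 (weakDeriv u) := h.memX.2.2.2

lemma continuous_zero (h : IsJet u p q r) : Continuous u :=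
  continuous_iff_continuousAt.2 fun x => (h.hasDerivAt_zero x).continuousAt

lemma continuous_one (h : IsJet u p q r) : Continuous p :=
  continuous_iff_continuousAt.2 fun x => (h.hasDerivAt_one x).continuousAt

lemma continuous_two (h : IsJet u p q r) : Continuous q :=
  continuous_iff_continuousAt.2 fun x => (h.hasDerivAt_two x).continuousAt

lemma memLp_one (h : IsJet u p q r) : MemLp p 2 volume :=
  (memLp_congr_ae h.ae_eq_one).2 (h.memH.2 0 (by norm_num))

lemma memLp_two (h : IsJet u p q r) : MemLp q 2 volume :=
  (memLp_congr_ae h.ae_eq_two).2 (h.memH.2 1 (by norm_num))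

lemma exists_bound_one (h : IsJet u p q r) : ∃ M : ℝ, ∀ x, ‖p x‖ ≤ M :=
  (h.memH.1 0 (by norm_num)).exists_bound h.continuous_one h.ae_eq_one
    (h.memH.2 0 (by norm_num)) (h.memH.2 1 (by norm_num))

lemma exists_bound_two (h : IsJet u p q r) : ∃ M : ℝ, ∀ x, ‖q x‖ ≤ M :=
  (h.memH.1 1 (by norm_num)).exists_bound h.continuous_two h.ae_eq_two
    (h.memH.2 1 (by norm_num)) (h.memH.2 2 (by norm_num))

lemma norm_sub_le (h : IsJet u p q r) {M : ℝ} (hM : ∀ x, ‖p x‖ ≤ M) (x y : ℝ) :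
    ‖u y - u x‖ ≤ M * |y - x| :=
  Convex.norm_image_sub_le_of_norm_hasDerivWithin_le
    (fun z _ => (h.hasDerivAt_zero z).hasDerivWithinAt) (fun z _ => hM z) convex_univ
    (Set.mem_univ x) (Set.mem_univ y)

end IsJet

/-- Some value is at most the average over a unit interval. This gives pointwise information on |u|,
which is controlled only through L² norms. -/
lemma exists_enorm_le_eLpNorm_two {g : ℝ → ℝ} (hg : AEStronglyMeasurable g volume) (x : ℝ) :
    ∃ y ∈ Set.Ioc x (x + 1), ‖g y‖ₑ ≤ eLpNorm g 2 volume := by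
  let μ : Measure ℝ := volume.restrict (Set.Ioc x (x + 1))
  have hμ : IsProbabilityMeasure μ := ⟨by simp [μ]⟩
  have h1 : eLpNorm g 1 μ ≤ eLpNorm g 2 volume :=
    (eLpNorm_le_eLpNorm_of_exponent_le (by norm_num) hg.restrict).trans
      (eLpNorm_mono_measure _ Measure.restrict_le_self)
  rw [eLpNorm_one_eq_lintegral_enorm] at h1
  obtain ⟨y, hy, hy'⟩ := exists_le_setLAverage (μ := volume) (s := Set.Ioc x (x + 1))
    (f := fun y => ‖g y‖ₑ) (by simp) (by simp)
    hg.restrict.enorm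
  refine ⟨y, hy, hy'.trans (le_trans (le_of_eq ?_) h1)⟩
  rw [setLAverage_eq]
  simp [μ]

/-- The part of U where a continuous function exceeds its essential supremum is open and null, hence
empty. -/
lemma enorm_le_eLpNorm_top_of_isOpen {E : Type*} [NormedAddCommGroup E] {f : ℝ → E} {U : Set ℝ}
    (hf : Continuous f) (hU : IsOpen U) {x : ℝ} (hx : x ∈ U) :
    ‖f x‖ₑ ≤ eLpNorm f ∞ (volume.restrict U) := by
  by_contra hlt
  rw [not_le] at hlt
  have hopen : IsOpen ({y | eLpNorm f ∞ (volume.restrict U) < ‖f y‖ₑ} ∩ U) :=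
    (isOpen_lt continuous_const hf.enorm).inter hU
  have hae : ∀ᵐ y ∂(volume.restrict U), ‖f y‖ₑ ≤ eLpNorm f ∞ (volume.restrict U) := by
    rw [eLpNorm_exponent_top]
    exact ae_le_eLpNormEssSup
  rw [ae_restrict_iff' hU.measurableSet] at hae
  have h0 : volume ({y | eLpNorm f ∞ (volume.restrict U) < ‖f y‖ₑ} ∩ U) = 0 := by
    rw [← nonpos_iff_eq_zero, ← (ae_iff.1 hae)]
    apply measure_mono
    intro y hy hy'
    exact absurd (hy' hy.2) (not_le.2 hy.1)
  rw [hopen.measure_eq_zero_iff volume] at h0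
  exact absurd (show x ∈ ({y | eLpNorm f ∞ (volume.restrict U) < ‖f y‖ₑ} ∩ U) from ⟨hlt, hx⟩)
    (by rw [h0]; exact Set.notMem_empty x)

namespace IsJet

variable {u p q r : ℝ → ℂ}

/-- Here u itself is not in L². Within distance 1 of any x there is a point y with |1 - |u(y)|²| ≤
N, and the bound L on ∂ₓu carries the estimate from y to x. -/
lemma exists_bound_zero (h : IsJet u p q r) : ∃ M : ℝ, ∀ x, ‖u x‖ ≤ M := by
  obtain ⟨L, hL⟩ := h.exists_bound_one
  have hη := h.memX.2.1
  set N := (eLpNorm (fun x => 1 - ‖u x‖ ^ 2) 2 volume).toReal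
  have hN : 0 ≤ N := ENNReal.toReal_nonneg
  have hL0 : 0 ≤ L := (norm_nonneg _).trans (hL 0)
  refine ⟨(1 + N) + L, fun x => ?_⟩
  obtain ⟨y, hy, hy'⟩ := exists_enorm_le_eLpNorm_two hη.1 x
  have h1 := ENNReal.toReal_mono hη.2.ne hy'
  rw [toReal_enorm, Real.norm_eq_abs] at h1
  have h2 : ‖u y‖ ≤ 1 + N := by
    have := (abs_le.1 h1).1
    nlinarith [norm_nonneg (u y)]
  have h3 := h.norm_sub_le hL y x
  have h4 : |x - y| ≤ 1 := by rw [abs_le]; constructor <;> linarith [hy.1, hy.2]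
  have h5 : ‖u x‖ ≤ ‖u y‖ + ‖u x - u y‖ := by
    have := norm_add_le (u y) (u x - u y)
    simpa using this
  nlinarith

lemma integrable_normSq_one (h : IsJet u p q r) : Integrable (fun x => ‖p x‖ ^ 2) volume :=
  h.memLp_one.norm.integrable_sq

lemma hasDerivAt_normSq_one (h : IsJet u p q r) (x : ℝ) :
    HasDerivAt (fun x => ‖p x‖ ^ 2) (2 * inner ℝ (p x) (q x)) x :=
  (h.hasDerivAt_one x).norm_sq

lemma integrable_inner (h : IsJet u p q r) :
    Integrable (fun x => 2 * inner ℝ (p x) (q x)) volume := by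
  have hI : Integrable (fun x => ‖p x‖ ^ 2 + ‖q x‖ ^ 2) volume :=
    h.integrable_normSq_one.add h.memLp_two.norm.integrable_sq
  refine hI.mono' (Continuous.aestronglyMeasurable ?_) (Eventually.of_forall fun x => ?_)
  · exact continuous_const.mul (h.continuous_one.inner h.continuous_two)
  · rw [norm_mul, Real.norm_eq_abs, Real.norm_eq_abs, abs_two]
    nlinarith [abs_real_inner_le_norm (p x) (q x), sq_nonneg (‖p x‖ - ‖q x‖)]

lemma tendsto_zero_of_normSq {l : Filter ℝ} (h : Tendsto (fun x => ‖p x‖ ^ 2) l (𝓝 0)) :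
    Tendsto p l (𝓝 0) := by
  rw [tendsto_zero_iff_norm_tendsto_zero]
  have := (Real.continuous_sqrt.tendsto 0).comp h
  rw [Real.sqrt_zero] at this
  refine this.congr fun x => ?_
  simp [Real.sqrt_sq]

/-- |∂ₓu|² is integrable with integrable derivative, so it tends to 0. This removes the energy flux
at infinity. -/
lemma tendsto_one_atTop (h : IsJet u p q r) : Tendsto p atTop (𝓝 0) :=
  tendsto_zero_of_normSq (tendsto_zero_of_hasDerivAt_of_integrableOn_Ioi (a := 0)
    (fun x _ => h.hasDerivAt_normSq_one x) h.integrable_inner.integrableOn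
    h.integrable_normSq_one.integrableOn)

lemma tendsto_one_atBot (h : IsJet u p q r) : Tendsto p atBot (𝓝 0) :=
  tendsto_zero_of_normSq (tendsto_zero_of_hasDerivAt_of_integrableOn_Iic (a := 0)
    (fun x _ => h.hasDerivAt_normSq_one x) h.integrable_inner.integrableOn
    h.integrable_normSq_one.integrableOn)

end IsJet

/-! ### Continuity in time -/

lemma normH_le_distX (k : ℕ) (A : ℝ) (u v : ℝ → ℂ) :
    normH (k - 1) (fun x => weakDeriv u x - weakDeriv v x) ≤ distX k A u v :=
  le_trans le_add_self le_self_add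

lemma eLpNorm_norm_sub_norm_le_distX (k : ℕ) (A : ℝ) (u v : ℝ → ℂ) :
    eLpNorm (fun x => ‖u x‖ - ‖v x‖) 2 volume ≤ distX k A u v :=
  le_add_self

/-- From the L^∞([-A, A]) part of the distance only the value at 0 is needed; the other values
follow by integrating ∂ₓu. -/
lemma enorm_sub_le_distX {A : ℝ} (hA : 0 < A) (k : ℕ) {u v : ℝ → ℂ} (hu : Continuous u)
    (hv : Continuous v) : ‖u 0 - v 0‖ₑ ≤ distX k A u v := by
  have h1 := enorm_le_eLpNorm_top_of_isOpen (hu.sub hv) (isOpen_Ioo (a := -A) (b := A))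
    (x := 0) ⟨by linarith, hA⟩
  refine h1.trans ((eLpNorm_mono_measure _ (Measure.restrict_mono Set.Ioo_subset_Icc_self
    le_rfl)).trans ?_)
  exact le_trans le_self_add le_self_add

lemma continuous_uncurry_of_tendstoUniformly {f : ℝ → ℝ → ℂ} (hc : ∀ t, Continuous (f t))
    (hu : ∀ t, TendstoUniformly f (f t) (𝓝 t)) : Continuous (fun z : ℝ × ℝ => f z.1 z.2) := by
  rw [continuous_iff_continuousAt]
  rintro ⟨t, x⟩
  rw [Metric.continuousAt_iff']
  intro ε hε
  have h1 := Metric.tendstoUniformly_iff.1 (hu t) (ε / 2) (by positivity)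
  have h2 := Metric.continuousAt_iff'.1 ((hc t).continuousAt (x := x)) (ε / 2) (by positivity)
  rw [nhds_prod_eq]
  filter_upwards [h1.prod_mk h2] with z hz
  have h3 := hz.1 z.2
  rw [dist_comm] at h3
  calc dist (f z.1 z.2) (f t x) ≤ dist (f z.1 z.2) (f t z.2) + dist (f t z.2) (f t x) :=
        dist_triangle _ _ _
    _ < ε := by linarith [hz.2]

lemma tendstoUniformly_of_enorm_le {f : ℝ → ℝ → ℂ} {t : ℝ} {d : ℝ → ℝ≥0∞}
    (hd : Tendsto d (𝓝 t) (𝓝 0)) (h : ∀ s x, ‖f s x - f t x‖ₑ ≤ d s) :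
    TendstoUniformly f (f t) (𝓝 t) := by
  rw [EMetric.tendstoUniformly_iff]
  intro ε hε
  filter_upwards [hd.eventually_lt_const hε] with s hs x
  rw [edist_comm, edist_eq_enorm_sub]
  exact (h s x).trans_lt hs

/-- A continuous curve in `X⁴`, with its first three derivatives in space. -/
structure IsJetCurve (A : ℝ) (Ψ p q r : ℝ → ℝ → ℂ) : Prop where
  pos : 0 < A
  isJet : ∀ t, IsJet (Ψ t) (p t) (q t) (r t)
  tendsto : ∀ t, Tendsto (fun s => distX 4 A (Ψ s) (Ψ t)) (𝓝 t) (𝓝 0)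

lemma exists_isJetCurve {A : ℝ} (hA : 0 < A) {Ψ : ℝ → ℝ → ℂ} (h : MemC0X 4 A Ψ) :
    ∃ p q r, IsJetCurve A Ψ p q r := by
  choose p q r hj using fun t => exists_isJet (h.1 t) (h.2.1 t)
  exact ⟨p, q, r, hA, hj, h.2.2⟩

namespace IsJetCurve

variable {A : ℝ} {Ψ p q r : ℝ → ℝ → ℂ}

lemma tendsto_two_mul (h : IsJetCurve A Ψ p q r) (t : ℝ) :
    Tendsto (fun s => 2 * distX 4 A (Ψ s) (Ψ t)) (𝓝 t) (𝓝 0) := by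
  have := ENNReal.Tendsto.const_mul (h.tendsto t) (a := 2) (Or.inr (by simp))
  rwa [mul_zero] at this

lemma tendstoUniformly_one (h : IsJetCurve A Ψ p q r) (t : ℝ) :
    TendstoUniformly p (p t) (𝓝 t) :=
  tendstoUniformly_of_enorm_le (h.tendsto_two_mul t) fun s x =>
    (enorm_sub_le_normH (h.isJet s).memH (h.isJet t).memH (j := 0) (by norm_num)
      (h.isJet s).continuous_one (h.isJet t).continuous_one (h.isJet s).ae_eq_one
      (h.isJet t).ae_eq_one x).trans (mul_le_mul_right (normH_le_distX 4 A _ _) 2)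

lemma tendstoUniformly_two (h : IsJetCurve A Ψ p q r) (t : ℝ) :
    TendstoUniformly q (q t) (𝓝 t) :=
  tendstoUniformly_of_enorm_le (h.tendsto_two_mul t) fun s x =>
    (enorm_sub_le_normH (h.isJet s).memH (h.isJet t).memH (j := 1) (by norm_num)
      (h.isJet s).continuous_two (h.isJet t).continuous_two (h.isJet s).ae_eq_two
      (h.isJet t).ae_eq_two x).trans (mul_le_mul_right (normH_le_distX 4 A _ _) 2)

lemma tendstoUniformly_three (h : IsJetCurve A Ψ p q r) (t : ℝ) :
    TendstoUniformly r (r t) (𝓝 t) :=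
  tendstoUniformly_of_enorm_le (h.tendsto_two_mul t) fun s x =>
    (enorm_sub_le_normH (h.isJet s).memH (h.isJet t).memH (j := 2) (by norm_num)
      (h.isJet s).continuous_three (h.isJet t).continuous_three (h.isJet s).ae_eq_three
      (h.isJet t).ae_eq_three x).trans (mul_le_mul_right (normH_le_distX 4 A _ _) 2)

lemma continuous_one (h : IsJetCurve A Ψ p q r) : Continuous (fun z : ℝ × ℝ => p z.1 z.2) :=
  continuous_uncurry_of_tendstoUniformly (fun t => (h.isJet t).continuous_one)
    h.tendstoUniformly_one

lemma continuous_two (h : IsJetCurve A Ψ p q r) : Continuous (fun z : ℝ × ℝ => q z.1 z.2) :=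
  continuous_uncurry_of_tendstoUniformly (fun t => (h.isJet t).continuous_two)
    h.tendstoUniformly_two

lemma continuous_three (h : IsJetCurve A Ψ p q r) : Continuous (fun z : ℝ × ℝ => r z.1 z.2) :=
  continuous_uncurry_of_tendstoUniformly (fun t => (h.isJet t).continuous_three)
    h.tendstoUniformly_three

/-- Unlike for the derivatives, `distX` does not control the supremum of Ψ(s) - Ψ(t) over the whole
line, since phases may drift apart slowly. Hence the representation Ψ(t, x) = Ψ(t, 0) + ∫₀ˣ ∂ₓΨ. -/
lemma continuous_zero (h : IsJetCurve A Ψ p q r) : Continuous (fun z : ℝ × ℝ => Ψ z.1 z.2) := by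
  have h0 : Continuous (fun s => Ψ s 0) := by
    rw [continuous_iff_continuousAt]
    intro t
    rw [ContinuousAt, EMetric.tendsto_nhds]
    intro ε hε
    filter_upwards [(h.tendsto t).eventually_lt_const hε] with s hs
    rw [edist_eq_enorm_sub]
    exact (enorm_sub_le_distX h.pos 4 (h.isJet s).continuous_zero
      (h.isJet t).continuous_zero).trans_lt hs
  have heq : (fun z : ℝ × ℝ => Ψ z.1 z.2) =
      fun z => Ψ z.1 0 + ∫ y in (0 : ℝ)..z.2, p z.1 y := by
    ext z
    rw [intervalIntegral.integral_eq_sub_of_hasDerivAt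
      (fun x _ => (h.isJet z.1).hasDerivAt_zero x)
      ((h.isJet z.1).continuous_one.intervalIntegrable _ _)]
    ring
  rw [heq]
  refine (h0.comp continuous_fst).add ?_
  exact intervalIntegral.continuous_parametric_intervalIntegral_of_continuous
    (f := fun (z : ℝ × ℝ) y => p z.1 y)
    (h.continuous_one.comp ((continuous_fst.comp continuous_fst).prodMk continuous_snd))
    continuous_snd

lemma eventually_bound (h : IsJetCurve A Ψ p q r) (t : ℝ) :
    ∃ M : ℝ, ∀ᶠ s in 𝓝 t, ∀ x, ‖Ψ s x‖ ≤ M ∧ ‖p s x‖ ≤ M ∧ ‖q s x‖ ≤ M := by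
  obtain ⟨M0, h0⟩ := (h.isJet t).exists_bound_zero
  obtain ⟨M1, h1⟩ := (h.isJet t).exists_bound_one
  obtain ⟨M2, h2⟩ := (h.isJet t).exists_bound_two
  have hM0 : 0 ≤ M0 := (norm_nonneg _).trans (h0 0)
  have hM1 : 0 ≤ M1 := (norm_nonneg _).trans (h1 0)
  have hM2 : 0 ≤ M2 := (norm_nonneg _).trans (h2 0)
  -- For s near t, the derivatives are at most M1 + 1 and M2 + 1. The modulus is at most M0 + 1 at
  -- some point within distance 1, which gives M0 + 1 + (M1 + 1) everywhere.
  refine ⟨M0 + M1 + M2 + 3, ?_⟩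
  filter_upwards [Metric.tendstoUniformly_iff.1 (h.tendstoUniformly_one t) 1 one_pos,
    Metric.tendstoUniformly_iff.1 (h.tendstoUniformly_two t) 1 one_pos,
    (h.tendsto t).eventually_lt_const one_pos] with s hp hq hd x
  have hps : ∀ x, ‖p s x‖ ≤ M1 + 1 := fun x => by
    have := hp x
    rw [dist_comm, dist_eq_norm] at this
    linarith [h1 x, norm_sub_norm_le (p s x) (p t x)]
  have hqs : ‖q s x‖ ≤ M2 + 1 := by
    have := hq x
    rw [dist_comm, dist_eq_norm] at this
    linarith [h2 x, norm_sub_norm_le (q s x) (q t x)]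
  refine ⟨?_, by linarith [hps x], by linarith⟩
  obtain ⟨y, hy, hy'⟩ := exists_enorm_le_eLpNorm_two (g := fun x => ‖Ψ s x‖ - ‖Ψ t x‖)
    ((h.isJet s).continuous_zero.norm.sub
      (h.isJet t).continuous_zero.norm).aestronglyMeasurable x
  have h3 : ‖Ψ s y‖ - ‖Ψ t y‖ ≤ 1 := by
    have h4 := (hy'.trans (eLpNorm_norm_sub_norm_le_distX 4 A _ _)).trans hd.le
    have := ENNReal.toReal_mono (by simp) h4
    rw [toReal_enorm, ENNReal.toReal_one] at this
    exact (le_abs_self _).trans this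
  have h4 := (h.isJet s).norm_sub_le hps y x
  have h5 : |x - y| ≤ 1 := by rw [abs_le]; constructor <;> linarith [hy.1, hy.2]
  have h6 := norm_sub_norm_le (Ψ s x) (Ψ s y)
  have h7 : (M1 + 1) * |x - y| ≤ M1 + 1 := by nlinarith
  linarith [h0 y]

lemma exists_bound (h : IsJetCurve A Ψ p q r) {K : Set ℝ} (hK : IsCompact K) :
    ∃ M : ℝ, ∀ s ∈ K, ∀ x, ‖Ψ s x‖ ≤ M ∧ ‖p s x‖ ≤ M ∧ ‖q s x‖ ≤ M := by
  refine hK.induction_on (p := fun K => ∃ M : ℝ, ∀ s ∈ K, ∀ x,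
    ‖Ψ s x‖ ≤ M ∧ ‖p s x‖ ≤ M ∧ ‖q s x‖ ≤ M) ⟨0, fun s hs => absurd hs (Set.notMem_empty s)⟩ ?_ ?_ ?_
  · rintro s t hst ⟨M, hM⟩
    exact ⟨M, fun a ha => hM a (hst ha)⟩
  · rintro s t ⟨M, hM⟩ ⟨N, hN⟩
    refine ⟨max M N, fun a ha x => ?_⟩
    rcases ha with ha | ha
    · obtain ⟨h1, h2, h3⟩ := hM a ha x
      exact ⟨h1.trans (le_max_left _ _), h2.trans (le_max_left _ _), h3.trans (le_max_left _ _)⟩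
    · obtain ⟨h1, h2, h3⟩ := hN a ha x
      exact ⟨h1.trans (le_max_right _ _), h2.trans (le_max_right _ _),
        h3.trans (le_max_right _ _)⟩
  · intro t _
    obtain ⟨M, hM⟩ := h.eventually_bound t
    exact ⟨_, mem_nhdsWithin_of_mem_nhds hM, M, fun s hs => hs⟩

end IsJetCurve

/-! ### Calculus for functions of time and space -/

lemma continuous_slice_left {E : Type*} [TopologicalSpace E] {f : ℝ → ℝ → E}
    (hf : Continuous (fun z : ℝ × ℝ => f z.1 z.2))
    (x : ℝ) :
    Continuous (fun t => f t x) :=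
  hf.comp (continuous_id.prodMk continuous_const)

lemma continuous_slice_right {E : Type*} [TopologicalSpace E] {f : ℝ → ℝ → E}
    (hf : Continuous (fun z : ℝ × ℝ => f z.1 z.2))
    (t : ℝ) : Continuous (f t) :=
  hf.comp (continuous_const.prodMk continuous_id)

section Calculus

variable {E : Type*} [NormedAddCommGroup E] [NormedSpace ℝ E]

lemma hasDerivAt_parametric_integral {F F' : ℝ → ℝ → E}
    (hF : Continuous (fun z : ℝ × ℝ => F z.1 z.2))
    (hF' : Continuous (fun z : ℝ × ℝ => F' z.1 z.2))
    (hd : ∀ t x, HasDerivAt (fun s => F s x) (F' t x) t) (a b t : ℝ) :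
    HasDerivAt (fun t => ∫ x in a..b, F t x) (∫ x in a..b, F' t x) t := by
  obtain ⟨M, hM⟩ := ((isCompact_closedBall t 1).prod (isCompact_uIcc (a := a) (b := b))).bddAbove_image
    (f := fun z : ℝ × ℝ => ‖F' z.1 z.2‖) hF'.norm.continuousOn
  refine (intervalIntegral.hasDerivAt_integral_of_dominated_loc_of_deriv_le
    (s := Metric.closedBall t 1) (bound := fun _ => M) (Metric.closedBall_mem_nhds t one_pos)
    (Eventually.of_forall fun s => (continuous_slice_right hF s).aestronglyMeasurable)
    ((continuous_slice_right hF t).intervalIntegrable _ _)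
    (continuous_slice_right hF' t).aestronglyMeasurable
    (Eventually.of_forall fun x hx s hs => hM ?_) intervalIntegrable_const
    (Eventually.of_forall fun x _ s _ => hd s x)).2
  exact ⟨(s, x), ⟨hs, Set.uIoc_subset_uIcc hx⟩, rfl⟩

/-- The chain rule along a line, for functions with continuous partial derivatives. -/
lemma hasDerivAt_along_line {f ft fx : ℝ → ℝ → E}
    (hft : ∀ t x, HasDerivAt (fun s => f s x) (ft t x) t)
    (hfx : ∀ t x, HasDerivAt (f t) (fx t x) x)
    (hct : Continuous (fun z : ℝ × ℝ => ft z.1 z.2))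
    (hcx : Continuous (fun z : ℝ × ℝ => fx z.1 z.2)) (c x t : ℝ) :
    HasDerivAt (fun s => f s (x + c * s)) (ft t (x + c * t) + c • fx t (x + c * t)) t := by
  have hF : ∀ z : ℝ × ℝ, HasStrictFDerivAt (fun z : ℝ × ℝ => f z.1 z.2)
      (((ContinuousLinearMap.toSpanSingleton ℝ (ft z.1 z.2)) : ℝ →L[ℝ] E).coprod
        (ContinuousLinearMap.toSpanSingleton ℝ (fx z.1 z.2))) z := fun z =>
    hasStrictFDerivAt_uncurry_coprod (f := f)
      (f₁ := fun t x => ContinuousLinearMap.toSpanSingleton ℝ (ft t x))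
      (f₂ := fun t x => ContinuousLinearMap.toSpanSingleton ℝ (fx t x))
      (Eventually.of_forall fun v => (hft v.1 v.2).hasFDerivAt)
      (Eventually.of_forall fun v => (hfx v.1 v.2).hasFDerivAt)
      ((ContinuousLinearMap.toSpanSingletonCLE (𝕜 := ℝ) (E := E)).continuous.comp
        hct).continuousAt
      ((ContinuousLinearMap.toSpanSingletonCLE (𝕜 := ℝ) (E := E)).continuous.comp
        hcx).continuousAt
  have hl : HasDerivAt (fun s : ℝ => (s, x + c * s)) ((1 : ℝ), c) t := by
    refine (hasDerivAt_id t).prodMk ?_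
    simpa using ((hasDerivAt_id t).const_mul c).const_add x
  have := (hF (t, x + c * t)).hasFDerivAt.comp_hasDerivAt t hl
  simpa [Function.comp_def] using this

variable [CompleteSpace E]

/-- A conservation law, integrated over a window that moves at a constant speed. -/
lemma integral_window_sub {w wx J Jx : ℝ → ℝ → E}
    (hwt : ∀ t x, HasDerivAt (fun s => w s x) (Jx t x) t)
    (hwx : ∀ t x, HasDerivAt (w t) (wx t x) x)
    (hJ : ∀ t x, HasDerivAt (J t) (Jx t x) x)
    (cw : Continuous (fun z : ℝ × ℝ => w z.1 z.2))
    (cwx : Continuous (fun z : ℝ × ℝ => wx z.1 z.2))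
    (cJ : Continuous (fun z : ℝ × ℝ => J z.1 z.2))
    (cJx : Continuous (fun z : ℝ × ℝ => Jx z.1 z.2)) (c a b t : ℝ) :
    (∫ x in (a + c * t)..(b + c * t), w t x) - ∫ x in a..b, w 0 x =
      ∫ s in (0 : ℝ)..t, ((J s (b + c * s) + c • w s (b + c * s)) -
        (J s (a + c * s) + c • w s (a + c * s))) := by
  have cl : Continuous (fun z : ℝ × ℝ => (z.1, z.2 + c * z.1)) := by fun_prop
  -- The conservation law is ∂ₜw = ∂ₓJ. In coordinates moving with the window the domain is fixed
  -- and the time derivative of the integrand is the exact derivative ∂ₓ(J + cw).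
  have hM : ∀ s, HasDerivAt (fun s => ∫ x in a..b, w s (x + c * s))
      (((J s (b + c * s) + c • w s (b + c * s)) -
        (J s (a + c * s) + c • w s (a + c * s)))) s := by
    intro s
    have h1 := hasDerivAt_parametric_integral (F := fun s x => w s (x + c * s))
      (F' := fun s x => Jx s (x + c * s) + c • wx s (x + c * s)) (cw.comp cl)
      ((cJx.comp cl).add ((cwx.comp cl).const_smul c))
      (fun s x => hasDerivAt_along_line hwt hwx cJx cwx c x s) a b s
    have h2 : ∫ x in a..b, (Jx s (x + c * s) + c • wx s (x + c * s)) =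
        (J s (b + c * s) + c • w s (b + c * s)) - (J s (a + c * s) + c • w s (a + c * s)) :=
      intervalIntegral.integral_eq_sub_of_hasDerivAt
        (f := fun x => J s (x + c * s) + c • w s (x + c * s))
        (fun x _ => ((hJ s _).comp_add_const x (c * s)).add
          (((hwx s _).comp_add_const x (c * s)).const_smul c))
        (((continuous_slice_right (f := fun s x => Jx s (x + c * s)) (cJx.comp cl) s).add
          ((continuous_slice_right (f := fun s x => wx s (x + c * s))
            (cwx.comp cl) s).const_smul c)).intervalIntegrable _ _)
    rwa [h2] at h1
  have ce : ∀ y, Continuous (fun s : ℝ => J s (y + c * s) + c • w s (y + c * s)) := fun y =>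
    (continuous_slice_left (f := fun s x => J s (x + c * s)) (cJ.comp cl) y).add
      ((continuous_slice_left (f := fun s x => w s (x + c * s))
      (cw.comp cl) y).const_smul c)
  rw [intervalIntegral.integral_eq_sub_of_hasDerivAt (fun s _ => hM s)
    (((ce b).sub (ce a)).intervalIntegrable _ _)]
  simp [intervalIntegral.integral_comp_add_right]

/-- The mixed derivatives: the time derivative of `∂ₓf` is `∂ₓ∂ₜf`. -/
lemma hasDerivAt_mixed {f fx G Gx : ℝ → ℝ → E}
    (hft : ∀ t x, HasDerivAt (fun s => f s x) (G t x) t)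
    (hfx : ∀ t x, HasDerivAt (f t) (fx t x) x)
    (hG : ∀ t x, HasDerivAt (G t) (Gx t x) x)
    (cG : Continuous (fun z : ℝ × ℝ => G z.1 z.2))
    (cGx : Continuous (fun z : ℝ × ℝ => Gx z.1 z.2)) (t x : ℝ) :
    HasDerivAt (fun s => fx s x) (Gx t x) t := by
  have csw : Continuous (fun z : ℝ × ℝ => (z.2, z.1)) := continuous_swap
  -- Differentiating f(t) = f(0) + ∫₀ᵗ G in x under the integral avoids any assumption on second
  -- derivatives of f.
  have h1 : ∀ t, fx t x = fx 0 x + ∫ s in (0 : ℝ)..t, Gx s x := by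
    intro t
    have h2 : f t = fun y => f 0 y + ∫ s in (0 : ℝ)..t, G s y := by
      ext y
      rw [intervalIntegral.integral_eq_sub_of_hasDerivAt (fun s _ => hft s y)
        ((continuous_slice_left cG y).intervalIntegrable _ _)]
      abel
    have h3 := (hfx 0 x).add (hasDerivAt_parametric_integral (F := fun y s => G s y)
      (F' := fun y s => Gx s y) (cG.comp csw) (cGx.comp csw) (fun y s => hG s y) 0 t x)
    have h4 := hfx t x
    rw [h2] at h4
    exact h4.unique h3
  have h5 : (fun s => fx s x) = fun t => fx 0 x + ∫ s in (0 : ℝ)..t, Gx s x := funext h1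
  rw [h5]
  have cx := continuous_slice_left cGx x
  exact (intervalIntegral.integral_hasDerivAt_right (cx.intervalIntegrable _ _)
      (cx.stronglyMeasurableAtFilter _ _) cx.continuousAt).const_add _

end Calculus

/-! ### Distributional solutions are classical -/

/-- The time derivative `i (∂ₓ²u + (1 - |u|²) u)` prescribed by the equation, where `q = ∂ₓ²u`. -/
noncomputable def velocity (u q : ℝ → ℂ) (x : ℝ) : ℂ :=
  Complex.I * (q x + ((1 - ‖u x‖ ^ 2 : ℝ) : ℂ) * u x)

lemma integral_iterated_deriv_smul {u p q r : ℝ → ℂ} (h : IsJet u p q r) {β : ℝ → ℝ}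
    (hβ : ContDiff ℝ ∞ β) (hc : HasCompactSupport β) :
    ∫ x, iteratedDeriv 2 β x • u x = ∫ x, β x • q x := by
  have hβ' : ContDiff ℝ ∞ (deriv β) := ((contDiff_infty_iff_deriv).1 hβ).2
  have h1 : HasWeakDeriv u p := h.memX.2.2.1.congr (ae_eq_refl _) h.ae_eq_one.symm
  have h2 : HasWeakDeriv p q := (h.memH.1 0 (by norm_num)).congr h.ae_eq_one.symm h.ae_eq_two.symm
  have h3 : iteratedDeriv 2 β = deriv (deriv β) := by
    rw [iteratedDeriv_succ, iteratedDeriv_one]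
  rw [h3, h1.2.2 (deriv β) hβ' hc.deriv, h2.2.2 β hβ hc, neg_neg]

lemma continuous_integral_smul {β : ℝ → ℝ} (hβ : Continuous β) (hc : HasCompactSupport β)
    {f : ℝ → ℝ → ℂ} (hf : Continuous (fun z : ℝ × ℝ => f z.1 z.2)) :
    Continuous (fun t => ∫ x, β x • f t x) := by
  obtain ⟨R, hR, h0, -⟩ := exists_abs_bound_of_hasCompactSupport hc
  have : (fun t => ∫ x, β x • f t x) = fun t => ∫ x in (-R)..R, β x • f t x := by
    ext t
    exact integral_eq_intervalIntegral_of_support fun x hx => by rw [h0 x hx, zero_smul]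
  rw [this]
  exact intervalIntegral.continuous_parametric_intervalIntegral_of_continuous'
    (f := fun t x => β x • f t x) ((hβ.comp continuous_snd).smul hf) _ _

/-- The inner integral of the distributional equation tested against α(t)β(x), at a fixed time where
a = α(t) and a' = α'(t). -/
lemma integral_weak_equation {u p q r : ℝ → ℂ} (h : IsJet u p q r) {β : ℝ → ℝ}
    (hβ : ContDiff ℝ ∞ β) (hc : HasCompactSupport β) (a a' : ℝ) :
    ∫ x, ((-(Complex.I * ((a' * β x : ℝ) : ℂ)) + ((a * iteratedDeriv 2 β x : ℝ) : ℂ)) * u x -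
        ((a * β x : ℝ) : ℂ) * (u x * ((‖u x‖ : ℂ) ^ 2 - 1))) =
      -Complex.I * (a' • (∫ x, β x • u x) + a • ∫ x, β x • velocity u q x) := by
  have hβ2 : Continuous (iteratedDeriv 2 β) := by
    rw [iteratedDeriv_succ, iteratedDeriv_one]
    exact ((contDiff_infty_iff_deriv).1 hβ).2.continuous_deriv (by simp)
  have hβ2c : HasCompactSupport (iteratedDeriv 2 β) := by
    rw [iteratedDeriv_succ, iteratedDeriv_one]
    exact hc.deriv.deriv
  have ct := h.continuous_zero
  have j1 := integrable_smul_of_locallyIntegrable ct.locallyIntegrable hβ.continuous hc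
  have j2 := integrable_smul_of_locallyIntegrable ct.locallyIntegrable hβ2 hβ2c
  have j3 := integrable_smul_of_locallyIntegrable
    (f := fun x => u x * ((‖u x‖ : ℂ) ^ 2 - 1))
    (Continuous.locallyIntegrable (by fun_prop)) hβ.continuous hc
  have j4 := integrable_smul_of_locallyIntegrable
    h.continuous_two.locallyIntegrable hβ.continuous hc
  have e1 : ∫ x, β x • velocity u q x = Complex.I * ((∫ x, β x • q x) -
      ∫ x, β x • (u x * ((‖u x‖ : ℂ) ^ 2 - 1))) := by
    rw [← integral_sub j4 j3, ← integral_const_mul]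
    congr 1
    ext x
    simp only [velocity, Complex.real_smul]
    push_cast
    ring
  rw [e1, ← integral_iterated_deriv_smul h hβ hc]
  have e2 : ∀ x, (-(Complex.I * ((a' * β x : ℝ) : ℂ)) +
    ((a * iteratedDeriv 2 β x : ℝ) : ℂ)) * u x -
      ((a * β x : ℝ) : ℂ) * (u x * ((‖u x‖ : ℂ) ^ 2 - 1)) =
      (-Complex.I * a') * (β x • u x) + (a : ℂ) * (iteratedDeriv 2 β x • u x) -
        (a : ℂ) * (β x • (u x * ((‖u x‖ : ℂ) ^ 2 - 1))) := by
    intro x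
    simp only [Complex.real_smul]
    push_cast
    ring
  simp only [e2]
  rw [integral_sub (by exact (j1.const_mul _).add (j2.const_mul _)) (j3.const_mul _),
    integral_add (j1.const_mul _) (j2.const_mul _), integral_const_mul, integral_const_mul,
    integral_const_mul]
  simp only [Complex.real_smul]
  linear_combination ((a : ℂ) * ((∫ x, ((iteratedDeriv 2 β x : ℝ) : ℂ) * u x) -
    ∫ x, (β x : ℂ) * (u x * ((‖u x‖ : ℂ) ^ 2 - 1)))) * Complex.I_mul_I

lemma hasCompactSupport_mul_prod {a b : ℝ → ℝ} (ha : HasCompactSupport a)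
    (hb : HasCompactSupport b) : HasCompactSupport (fun z : ℝ × ℝ => a z.1 * b z.2) := by
  apply HasCompactSupport.of_support_subset_isCompact (ha.isCompact.prod hb.isCompact)
  intro z hz
  rw [Function.mem_support] at hz
  exact ⟨subset_tsupport _ (left_ne_zero_of_mul hz), subset_tsupport _ (right_ne_zero_of_mul hz)⟩

namespace IsJetCurve

variable {A : ℝ} {Ψ p q r : ℝ → ℝ → ℂ}

lemma continuous_velocity (h : IsJetCurve A Ψ p q r) :
    Continuous (fun z : ℝ × ℝ => velocity (Ψ z.1) (q z.1) z.2) := by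
  have h0 := h.continuous_zero
  have h2 := h.continuous_two
  unfold velocity
  exact continuous_const.mul (h2.add ((Complex.continuous_ofReal.comp
    (continuous_const.sub (h0.norm.pow 2))).mul h0))

/-- Test functions α(t)β(x) suffice: by Fubini the equation becomes, for each β, a weak differential
equation in time. -/
lemma hasWeakDeriv_pairing (h : IsJetCurve A Ψ p q r) (hs : SolvesGP Ψ) {β : ℝ → ℝ}
    (hβ : ContDiff ℝ ∞ β) (hc : HasCompactSupport β) :
    HasWeakDeriv (fun t => ∫ x, β x • Ψ t x) (fun t => ∫ x, β x • velocity (Ψ t) (q t) x) := by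
  have cm := continuous_integral_smul hβ.continuous hc h.continuous_zero
  have cg := continuous_integral_smul (f := fun t x => velocity (Ψ t) (q t) x) hβ.continuous hc
    h.continuous_velocity
  have c0 := h.continuous_zero
  refine ⟨cm.locallyIntegrable, cg.locallyIntegrable, fun α hα hαc => ?_⟩
  have hα' : Continuous (deriv α) := hα.continuous_deriv (by simp)
  have hβ2 : Continuous (iteratedDeriv 2 β) := by
    rw [iteratedDeriv_succ, iteratedDeriv_one]
    exact ((contDiff_infty_iff_deriv).1 hβ).2.continuous_deriv (by simp)
  have hβ2c : HasCompactSupport (iteratedDeriv 2 β) := by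
    rw [iteratedDeriv_succ, iteratedDeriv_one]
    exact hc.deriv.deriv
  have key := hs (fun z => α z.1 * β z.2) ((hα.comp contDiff_fst).mul (hβ.comp contDiff_snd))
    (hasCompactSupport_mul_prod hαc hc)
  have d1 : ∀ a b : ℝ, deriv (fun s => α s * b) a = deriv α a * b := fun a b =>
    deriv_mul_const_field (u := α) b
  have d2 : ∀ a b : ℝ, iteratedDeriv 2 (fun y => a * β y) b =
      a * iteratedDeriv 2 β b := fun a b => iteratedDeriv_const_mul_field a β
  simp only [d1, d2] at key
  have i1 : Integrable (fun z : ℝ × ℝ => (-(Complex.I * ((deriv α z.1 * β z.2 : ℝ) : ℂ)) +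
      ((α z.1 * iteratedDeriv 2 β z.2 : ℝ) : ℂ)) * Ψ z.1 z.2) (volume.prod volume) := by
    apply Continuous.integrable_of_hasCompactSupport
    · exact ((continuous_const.mul (Complex.continuous_ofReal.comp
        ((hα'.comp continuous_fst).mul (hβ.continuous.comp continuous_snd)))).neg.add
        (Complex.continuous_ofReal.comp
        ((hα.continuous.comp continuous_fst).mul (hβ2.comp continuous_snd)))).mul c0
    · apply HasCompactSupport.mul_right
      refine HasCompactSupport.add (HasCompactSupport.neg (HasCompactSupport.mul_left ?_)) ?_
      · exact (hasCompactSupport_mul_prod hαc.deriv hc).comp_left (g := fun x : ℝ => (x : ℂ)) rfl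
      · exact (hasCompactSupport_mul_prod hαc hβ2c).comp_left (g := fun x : ℝ => (x : ℂ)) rfl
  have i2 : Integrable (fun z : ℝ × ℝ =>
      ((α z.1 * β z.2 : ℝ) : ℂ) * (Ψ z.1 z.2 * ((‖Ψ z.1 z.2‖ : ℂ) ^ 2 - 1)))
      (volume.prod volume) := by
    apply Continuous.integrable_of_hasCompactSupport
    · exact (Complex.continuous_ofReal.comp
        ((hα.continuous.comp continuous_fst).mul (hβ.continuous.comp continuous_snd))).mul
        (c0.mul (((Complex.continuous_ofReal.comp c0.norm).pow 2).sub continuous_const))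
    · apply HasCompactSupport.mul_right
      exact (hasCompactSupport_mul_prod hαc hc).comp_left (g := fun x : ℝ => (x : ℂ)) rfl
  rw [Measure.volume_eq_prod, ← sub_eq_zero, ← integral_sub i1 i2] at key
  rw [integral_prod _ (by exact i1.sub i2)] at key
  replace key : ∫ t, -Complex.I * (deriv α t • (∫ x, β x • Ψ t x) +
      α t • ∫ x, β x • velocity (Ψ t) (q t) x) = 0 := by
    rw [← key]
    congr 1
    ext t
    exact (integral_weak_equation (h.isJet t) hβ hc (α t) (deriv α t)).symm
  rw [integral_const_mul, integral_add
    (integrable_smul_of_locallyIntegrable cm.locallyIntegrable hα' hαc.deriv)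
    (integrable_smul_of_locallyIntegrable cg.locallyIntegrable hα.continuous hαc)] at key
  have := (mul_eq_zero.1 key).resolve_left (by simp)
  exact eq_neg_of_add_eq_zero_left this

lemma sub_eq_integral_velocity (h : IsJetCurve A Ψ p q r) (hs : SolvesGP Ψ) (t x : ℝ) :
    Ψ t x - Ψ 0 x = ∫ s in (0 : ℝ)..t, velocity (Ψ s) (q s) x := by
  have cv := h.continuous_velocity
  have cI : Continuous (fun z : ℝ × ℝ => ∫ s in (0 : ℝ)..z.1, velocity (Ψ s) (q s) z.2) :=
    intervalIntegral.continuous_parametric_intervalIntegral_of_continuous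
      (f := fun (z : ℝ × ℝ) s => velocity (Ψ s) (q s) z.2)
      (cv.comp (continuous_snd.prodMk (continuous_snd.comp continuous_fst))) continuous_fst
  have ct := (h.isJet t).continuous_zero
  have c0 := (h.isJet 0).continuous_zero
  have cIt : Continuous (fun x => ∫ s in (0 : ℝ)..t, velocity (Ψ s) (q s) x) :=
    cI.comp (continuous_const.prodMk continuous_id)
  have hae : (fun x => Ψ t x - Ψ 0 x) =ᵐ[volume]
      fun x => ∫ s in (0 : ℝ)..t, velocity (Ψ s) (q s) x := by
    apply ae_eq_of_integral_contDiff_smul_eq (ct.sub c0).locallyIntegrable cIt.locallyIntegrable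
    intro β hβ hc
    have h1 := (h.hasWeakDeriv_pairing hs hβ hc).sub_eq_integral
      (continuous_integral_smul hβ.continuous hc h.continuous_zero) (ae_eq_refl _) 0 t
    show ∫ x, β x • (Ψ t x - Ψ 0 x) = _
    simp only [smul_sub]
    rw [integral_sub (integrable_smul_of_locallyIntegrable ct.locallyIntegrable hβ.continuous hc)
      (integrable_smul_of_locallyIntegrable c0.locallyIntegrable hβ.continuous hc), h1]
    obtain ⟨R, hR, hz, -⟩ := exists_abs_bound_of_hasCompactSupport hc
    -- The time integral and the pairing with β are exchanged by comparing derivatives in t; both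
    -- sides vanish at t = 0.
    have hN : ∀ t, HasDerivAt (fun t => ∫ x in (-R)..R,
        β x • ∫ s in (0 : ℝ)..t, velocity (Ψ s) (q s) x)
        (∫ x in (-R)..R, β x • velocity (Ψ t) (q t) x) t := by
      refine hasDerivAt_parametric_integral
        (F := fun t x => β x • ∫ s in (0 : ℝ)..t, velocity (Ψ s) (q s) x)
        (F' := fun t x => β x • velocity (Ψ t) (q t) x)
        ((hβ.continuous.comp continuous_snd).smul cI)
        ((hβ.continuous.comp continuous_snd).smul cv) (fun t x => ?_) (-R) R
      have cx := continuous_slice_left (f := fun s x => velocity (Ψ s) (q s) x) cv x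
      have hd := intervalIntegral.integral_hasDerivAt_right (cx.intervalIntegrable 0 t)
        (cx.stronglyMeasurableAtFilter _ _) cx.continuousAt
      exact hd.const_smul (β x)
    have e1 : ∀ t, ∫ x, β x • velocity (Ψ t) (q t) x =
        ∫ x in (-R)..R, β x • velocity (Ψ t) (q t) x := fun t =>
      integral_eq_intervalIntegral_of_support fun x hx => by rw [hz x hx, zero_smul]
    have e2 : ∫ x, β x • ∫ s in (0 : ℝ)..t, velocity (Ψ s) (q s) x =
        ∫ x in (-R)..R, β x • ∫ s in (0 : ℝ)..t, velocity (Ψ s) (q s) x :=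
      integral_eq_intervalIntegral_of_support fun x hx => by rw [hz x hx, zero_smul]
    have cg := continuous_integral_smul (f := fun t x => velocity (Ψ t) (q t) x) hβ.continuous hc cv
    rw [funext e1] at cg
    rw [intervalIntegral.integral_congr (fun t _ => e1 t), e2,
      intervalIntegral.integral_eq_sub_of_hasDerivAt (fun s _ => hN s)
      (cg.intervalIntegrable _ _)]
    simp
  exact congrFun ((ct.sub c0).ae_eq_iff_eq volume cIt |>.1 hae) x

/-- A distributional solution is differentiable in time, and solves the equation classically. -/
lemma hasDerivAt_time (h : IsJetCurve A Ψ p q r) (hs : SolvesGP Ψ) (t x : ℝ) :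
    HasDerivAt (fun s => Ψ s x) (velocity (Ψ t) (q t) x) t := by
  have heq : (fun s => Ψ s x) = fun t => Ψ 0 x + ∫ s in (0 : ℝ)..t, velocity (Ψ s) (q s) x := by
    ext t
    rw [← h.sub_eq_integral_velocity hs t x]
    ring
  have cx := continuous_slice_left (f := fun s x => velocity (Ψ s) (q s) x)
    h.continuous_velocity x
  rw [heq]
  exact (intervalIntegral.integral_hasDerivAt_right (cx.intervalIntegrable _ _)
    (cx.stronglyMeasurableAtFilter _ _) cx.continuousAt).const_add _

end IsJetCurve

/-! ### Conservation of the energy -/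

/-- The energy density, where `p = ∂ₓu`. -/
noncomputable def energyDensity (u p : ℝ → ℂ) (x : ℝ) : ℝ :=
  1 / 2 * ‖p x‖ ^ 2 + 1 / 4 * eta u x ^ 2

/-- The space derivative of `velocity`. -/
noncomputable def velocityDeriv (u p r : ℝ → ℂ) (x : ℝ) : ℂ :=
  Complex.I * (r x + (((1 - ‖u x‖ ^ 2 : ℝ) : ℂ) * p x +
    ((-(2 * inner ℝ (u x) (p x)) : ℝ) : ℂ) * u x))

namespace IsJet

variable {u p q r : ℝ → ℂ}

lemma integrable_eta_sq (h : IsJet u p q r) : Integrable (fun x => eta u x ^ 2) volume :=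
  h.memX.2.1.integrable_sq

lemma integrable_energyDensity (h : IsJet u p q r) : Integrable (energyDensity u p) volume :=
  (h.integrable_normSq_one.const_mul _).add (h.integrable_eta_sq.const_mul _)

lemma energy_eq (h : IsJet u p q r) : energy u = ∫ x, energyDensity u p x := by
  unfold energyDensity energy
  rw [integral_add (h.integrable_normSq_one.const_mul _) (h.integrable_eta_sq.const_mul _),
    integral_const_mul, integral_const_mul]
  congr 2
  apply integral_congr_ae
  filter_upwards [h.ae_eq_one] with x hx
  rw [hx]

lemma hasDerivAt_eta (h : IsJet u p q r) (x : ℝ) :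
    HasDerivAt (eta u) (-(2 * inner ℝ (u x) (p x))) x :=
  (h.hasDerivAt_zero x).norm_sq.const_sub 1

lemma hasDerivAt_velocity (h : IsJet u p q r) (x : ℝ) :
    HasDerivAt (velocity u q) (velocityDeriv u p r x) x := by
  have h1 := (h.hasDerivAt_eta x).ofReal_comp.mul (h.hasDerivAt_zero x)
  have h2 := ((h.hasDerivAt_two x).add h1).const_mul Complex.I
  refine h2.congr_deriv ?_
  simp only [velocityDeriv, eta]
  ring

end IsJet

lemma norm_velocity_le {u q : ℝ → ℂ} {x M : ℝ} (hu : ‖u x‖ ≤ M) (hq : ‖q x‖ ≤ M) :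
    ‖velocity u q x‖ ≤ M + (1 + M ^ 2) * M := by
  have hM : 0 ≤ M := (norm_nonneg _).trans hu
  unfold velocity
  rw [norm_mul, Complex.norm_I, one_mul]
  refine (norm_add_le _ _).trans (add_le_add hq ?_)
  rw [norm_mul, Complex.norm_real, Real.norm_eq_abs]
  have h1 : |1 - ‖u x‖ ^ 2| ≤ 1 + M ^ 2 := by
    rw [abs_le]
    constructor <;> nlinarith [norm_nonneg (u x)]
  exact mul_le_mul h1 hu (norm_nonneg _) (by positivity)

namespace IsJetCurve

variable {A : ℝ} {Ψ p q r : ℝ → ℝ → ℂ}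

lemma continuous_velocityDeriv (h : IsJetCurve A Ψ p q r) :
    Continuous (fun z : ℝ × ℝ => velocityDeriv (Ψ z.1) (p z.1) (r z.1) z.2) := by
  have h0 := h.continuous_zero
  have h1 := h.continuous_one
  have h3 := h.continuous_three
  unfold velocityDeriv
  exact continuous_const.mul (h3.add (((Complex.continuous_ofReal.comp
    (continuous_const.sub (h0.norm.pow 2))).mul h1).add ((Complex.continuous_ofReal.comp
    (continuous_const.mul (h0.inner h1)).neg).mul h0)))

lemma hasDerivAt_time_one (h : IsJetCurve A Ψ p q r) (hs : SolvesGP Ψ) (t x : ℝ) :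
    HasDerivAt (fun s => p s x) (velocityDeriv (Ψ t) (p t) (r t) x) t :=
  hasDerivAt_mixed (f := Ψ) (G := fun t x => velocity (Ψ t) (q t) x)
    (Gx := fun t x => velocityDeriv (Ψ t) (p t) (r t) x) (h.hasDerivAt_time hs)
    (fun t => (h.isJet t).hasDerivAt_zero) (fun t => (h.isJet t).hasDerivAt_velocity)
    h.continuous_velocity h.continuous_velocityDeriv t x

/-- The local law is ∂ₜe = ∂ₓ⟨∂ₓΨ, ∂ₜΨ⟩. It holds because ∂ₜΨ = i(∂ₓ²Ψ + ηΨ) is orthogonal to ∂ₓ²Ψ +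
ηΨ. The window is at rest. -/
lemma integral_energyDensity_sub (h : IsJetCurve A Ψ p q r) (hs : SolvesGP Ψ) (a b t : ℝ) :
    (∫ x in a..b, energyDensity (Ψ t) (p t) x) - ∫ x in a..b, energyDensity (Ψ 0) (p 0) x =
      ∫ s in (0 : ℝ)..t, (inner ℝ (p s b) (velocity (Ψ s) (q s) b) -
        inner ℝ (p s a) (velocity (Ψ s) (q s) a)) := by
  have h0 := h.continuous_zero
  have h1 := h.continuous_one
  have h2 := h.continuous_two
  have cη : Continuous (fun z : ℝ × ℝ => eta (Ψ z.1) z.2) := continuous_const.sub (h0.norm.pow 2)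
  have key := integral_window_sub (w := fun t x => energyDensity (Ψ t) (p t) x)
    (wx := fun t x => inner ℝ (p t x) (q t x) - eta (Ψ t) x * inner ℝ (Ψ t x) (p t x))
    (J := fun t x => inner ℝ (p t x) (velocity (Ψ t) (q t) x))
    (Jx := fun t x => inner ℝ (p t x) (velocityDeriv (Ψ t) (p t) (r t) x) +
      inner ℝ (q t x) (velocity (Ψ t) (q t) x)) ?_ ?_ ?_ ?_ ?_ ?_ ?_ 0 a b t
  · simpa using key
  · intro t x
    have e1 := ((h.hasDerivAt_time_one hs t x).norm_sq).const_mul (1 / 2 : ℝ)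
    have e2 := (((h.hasDerivAt_time hs t x).norm_sq.const_sub 1).pow 2).const_mul (1 / 4 : ℝ)
    refine (e1.add e2).congr_deriv ?_
    simp only [velocity, Complex.inner, Complex.mul_re, Complex.mul_im, Complex.add_re,
      Complex.add_im, Complex.conj_re, Complex.conj_im, Complex.ofReal_re, Complex.ofReal_im,
      Complex.I_re, Complex.I_im]
    ring
  · intro t x
    have e1 := (((h.isJet t).hasDerivAt_one x).norm_sq).const_mul (1 / 2 : ℝ)
    have e2 := (((h.isJet t).hasDerivAt_eta x).pow 2).const_mul (1 / 4 : ℝ)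
    refine (e1.add e2).congr_deriv ?_
    ring
  · exact fun t x => ((h.isJet t).hasDerivAt_one x).inner ℝ ((h.isJet t).hasDerivAt_velocity x)
  · exact (continuous_const.mul (h1.norm.pow 2)).add (continuous_const.mul (cη.pow 2))
  · exact (h1.inner h2).sub (cη.mul (h0.inner h1))
  · exact h1.inner h.continuous_velocity
  · exact (h1.inner h.continuous_velocityDeriv).add (h2.inner h.continuous_velocity)

/-- The energy is conserved. -/
theorem energy_eq (h : IsJetCurve A Ψ p q r) (hs : SolvesGP Ψ) (t : ℝ) :
    energy (Ψ t) = energy (Ψ 0) := by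
  have hl : ∀ s, Tendsto (fun n : ℝ => ∫ x in (-n)..n, energyDensity (Ψ s) (p s) x) atTop
      (𝓝 (energy (Ψ s))) := fun s => by
    rw [(h.isJet s).energy_eq]
    exact intervalIntegral_tendsto_integral (h.isJet s).integrable_energyDensity
      tendsto_neg_atTop_atBot tendsto_id
  have h1 := (hl t).sub (hl 0)
  simp only [h.integral_energyDensity_sub hs] at h1
  obtain ⟨M, hM⟩ := h.exists_bound (isCompact_uIcc (a := 0) (b := t))
  set C := M + (1 + M ^ 2) * M with hC
  have hv : ∀ s ∈ Set.uIcc 0 t, ∀ x, |inner ℝ (p s x) (velocity (Ψ s) (q s) x)| ≤ ‖p s x‖ * C := by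
    intro s hs x
    obtain ⟨a1, a2, a3⟩ := hM s hs x
    exact (abs_real_inner_le_norm _ _).trans
      (mul_le_mul_of_nonneg_left (norm_velocity_le a1 a3) (norm_nonneg _))
  have hJ : ∀ s ∈ Set.uIcc 0 t, ∀ x, |inner ℝ (p s x) (velocity (Ψ s) (q s) x)| ≤ M * C := by
    intro s hs x
    obtain ⟨a1, a2, a3⟩ := hM s hs x
    refine (hv s hs x).trans (mul_le_mul_of_nonneg_right a2 ?_)
    have : 0 ≤ M := (norm_nonneg _).trans a1
    positivity
  have cJ : ∀ x, Continuous (fun s => inner ℝ (p s x) (velocity (Ψ s) (q s) x)) := fun x =>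
    continuous_slice_left (f := fun s x => (inner ℝ (p s x) (velocity (Ψ s) (q s) x) : ℝ))
      (h.continuous_one.inner h.continuous_velocity) x
  have hz : ∀ s ∈ Set.uIcc 0 t, ∀ l : Filter ℝ, Tendsto (p s) l (𝓝 0) →
      Tendsto (fun x => inner ℝ (p s x) (velocity (Ψ s) (q s) x)) l (𝓝 (0 : ℝ)) := by
    intro s hs l hp
    refine squeeze_zero_norm (hv s hs) ?_
    simpa using hp.norm.mul_const C
  -- At each time the flux through ±n vanishes in the limit with ∂ₓΨ; the bounds on [0, t] × ℝ
  -- provide the domination.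
  have h2 : Tendsto (fun n : ℝ => ∫ s in (0 : ℝ)..t, (inner ℝ (p s n) (velocity (Ψ s) (q s) n) -
      inner ℝ (p s (-n)) (velocity (Ψ s) (q s) (-n)))) atTop
      (𝓝 (∫ _ in (0 : ℝ)..t, (0 : ℝ))) := by
    apply intervalIntegral.tendsto_integral_filter_of_dominated_convergence (fun _ => M * C + M * C)
    · exact Eventually.of_forall fun n => ((cJ n).sub (cJ (-n))).aestronglyMeasurable
    · refine Eventually.of_forall fun n => Eventually.of_forall fun s hs => ?_
      have hs' := Set.uIoc_subset_uIcc hs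
      exact (abs_sub _ _).trans (add_le_add (hJ s hs' n) (hJ s hs' (-n)))
    · exact intervalIntegrable_const
    · refine Eventually.of_forall fun s hs => ?_
      have hs' := Set.uIoc_subset_uIcc hs
      have := (hz s hs' atTop (h.isJet s).tendsto_one_atTop).sub
        ((hz s hs' atBot (h.isJet s).tendsto_one_atBot).comp tendsto_neg_atTop_atBot)
      rw [sub_zero] at this
      exact this
  rw [intervalIntegral.integral_zero] at h2
  exact sub_eq_zero.1 (tendsto_nhds_unique h1 h2)

end IsJetCurve

/-! ### Solutions of small energy do not vanish -/

/-- An antiderivative of `(1 - y) / (2 √(y + ε))`. -/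
noncomputable def modica (ε y : ℝ) : ℝ := (1 + ε) * √(y + ε) - √(y + ε) ^ 3 / 3

lemma hasDerivAt_modica {ε y : ℝ} (hy : 0 < y + ε) :
    HasDerivAt (modica ε) ((1 - y) / (2 * √(y + ε))) y := by
  have h1 : HasDerivAt (fun y => √(y + ε)) (1 / (2 * √(y + ε))) y :=
    ((hasDerivAt_id y).add_const ε).sqrt hy.ne'
  have h2 := (h1.const_mul (1 + ε)).sub ((h1.pow 3).div_const 3)
  refine h2.congr_deriv ?_
  have h3 : √(y + ε) ≠ 0 := (Real.sqrt_pos.2 hy).ne'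
  have h4 : √(y + ε) ^ 2 = y + ε := Real.sq_sqrt hy.le
  field_simp
  norm_num
  linear_combination -3 * h4

/-- Modica-Mortola: ½|p|² + ¼η² ≥ (√2/2)|η||p|, and |η||p| dominates the derivative of `modica ε (‖u
x‖ ^ 2)`. The parameter ε keeps the square root smooth at zeros of u. -/
lemma IsJet.abs_modica_sub_le {u p q r : ℝ → ℂ} (h : IsJet u p q r) {ε : ℝ} (hε : 0 < ε) {a b : ℝ}
    (hab : a ≤ b) : √2 / 2 * |modica ε (‖u b‖ ^ 2) - modica ε (‖u a‖ ^ 2)| ≤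
      ∫ x in a..b, energyDensity u p x := by
  have cu := h.continuous_zero
  have cp := h.continuous_one
  have hpos : ∀ x, 0 < ‖u x‖ ^ 2 + ε := fun x => by positivity
  have hd : ∀ x, HasDerivAt (fun x => √2 / 2 * modica ε (‖u x‖ ^ 2))
      (√2 / 2 * ((1 - ‖u x‖ ^ 2) / (2 * √(‖u x‖ ^ 2 + ε)) * (2 * inner ℝ (u x) (p x)))) x := fun x =>
    ((hasDerivAt_modica (hpos x)).comp x (h.hasDerivAt_zero x).norm_sq).const_mul _
  have hc : Continuous fun x => √2 / 2 * ((1 - ‖u x‖ ^ 2) / (2 * √(‖u x‖ ^ 2 + ε)) *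
      (2 * inner ℝ (u x) (p x))) := by
    refine continuous_const.mul (((continuous_const.sub (cu.norm.pow 2)).div
      (continuous_const.mul ((cu.norm.pow 2).add continuous_const).sqrt) fun x => ?_).mul
        (continuous_const.mul (cu.inner cp)))
    exact (mul_pos two_pos (Real.sqrt_pos.2 (hpos x))).ne'
  rw [← abs_of_pos (show 0 < √2 / 2 by positivity), ← abs_mul, mul_sub,
    ← intervalIntegral.integral_eq_sub_of_hasDerivAt (fun x _ => hd x)
    (hc.intervalIntegrable _ _)]
  rw [← Real.norm_eq_abs]
  refine intervalIntegral.norm_integral_le_of_norm_le hab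
    (Eventually.of_forall fun x _ => ?_) h.integrable_energyDensity.intervalIntegrable
  have hs := Real.sqrt_pos.2 (hpos x)
  have hus : ‖u x‖ ≤ √(‖u x‖ ^ 2 + ε) := Real.le_sqrt_of_sq_le (by linarith)
  have h1 : |(1 - ‖u x‖ ^ 2) / (2 * √(‖u x‖ ^ 2 + ε)) * (2 * inner ℝ (u x) (p x))| ≤
      |eta u x| * ‖p x‖ := by
    rw [abs_mul, abs_div, abs_mul, abs_mul, abs_two, abs_of_pos hs, div_mul_eq_mul_div,
      div_le_iff₀ (by positivity)]
    have h2 := (abs_real_inner_le_norm (u x) (p x)).trans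
      (mul_le_mul_of_nonneg_right hus (norm_nonneg (p x)))
    have h3 := mul_le_mul_of_nonneg_left h2 (abs_nonneg (eta u x))
    unfold eta at h3 ⊢
    linarith
  have h2 : (√2) ^ 2 = 2 := Real.sq_sqrt (by norm_num)
  have h3 : √2 / 2 * (|eta u x| * ‖p x‖) ≤ energyDensity u p x := by
    unfold energyDensity
    rw [← sq_abs (eta u x)]
    nlinarith [sq_nonneg (√2 * ‖p x‖ - |eta u x|)]
  rw [Real.norm_eq_abs, abs_mul, abs_of_pos (show 0 < √2 / 2 by positivity)]
  exact (mul_le_mul_of_nonneg_left h1 (by positivity)).trans h3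

lemma exists_mem_lt_of_integrableOn {f : ℝ → ℝ} {s : Set ℝ} (hs : MeasurableSet s)
    (hv : volume s = ⊤) (hf : IntegrableOn f s volume) {δ : ℝ} (hδ : 0 < δ) :
    ∃ x ∈ s, f x < δ := by
  by_contra! h
  have h1 : IntegrableOn (fun _ : ℝ => δ) s volume := by
    refine Integrable.mono' hf aestronglyMeasurable_const ?_
    filter_upwards [ae_restrict_mem hs] with x hx
    rw [Real.norm_eq_abs, abs_of_pos hδ]
    exact h x hx
  rw [integrableOn_const_iff] at h1
  rcases h1 with h1 | h1
  · exact hδ.ne' (by simpa using h1)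
  · rw [hv] at h1
    exact lt_irrefl _ h1

lemma energyDensity_nonneg (u p : ℝ → ℂ) (x : ℝ) : 0 ≤ energyDensity u p x := by
  unfold energyDensity
  positivity

/-- Since η² is integrable, |u| is arbitrarily close to 1 at points on both sides of x. The descent
to |u(x)| and the return each cost √2/2 times the drop, whence the factor √2. -/
lemma IsJet.modica_sub_le_energy {u p q r : ℝ → ℂ} (h : IsJet u p q r) {ε : ℝ} (hε : 0 < ε)
    (x : ℝ) : √2 * (modica ε 1 - modica ε (‖u x‖ ^ 2)) ≤ energy u := by
  have hcont : ContinuousAt (modica ε) 1 := (hasDerivAt_modica (by linarith)).continuousAt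
  have h2 : 0 < √2 := by positivity
  refine le_of_forall_pos_le_add fun κ hκ => ?_
  obtain ⟨δ, hδ, hδ'⟩ := Metric.continuousAt_iff.1 hcont (κ / √2) (by positivity)
  have hclose : ∀ y, eta u y ^ 2 < δ ^ 2 → modica ε 1 - κ / √2 < modica ε (‖u y‖ ^ 2) := by
    intro y hy
    have h3 := abs_lt_of_sq_lt_sq hy hδ.le
    have h4 := hδ' (x := ‖u y‖ ^ 2) (by rwa [Real.dist_eq, abs_sub_comm])
    rw [Real.dist_eq] at h4
    linarith [(abs_lt.1 h4).1]
  obtain ⟨b, hb, hb'⟩ := exists_mem_lt_of_integrableOn (s := Set.Ici x) measurableSet_Ici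
    (by simp) h.integrable_eta_sq.integrableOn (pow_pos hδ 2)
  obtain ⟨a, ha, ha'⟩ := exists_mem_lt_of_integrableOn (s := Set.Iic x) measurableSet_Iic
    (by simp) h.integrable_eta_sq.integrableOn (pow_pos hδ 2)
  have h5 := h.abs_modica_sub_le hε hb
  have h6 := h.abs_modica_sub_le hε ha
  have hI := h.integrable_energyDensity
  have h7 : ∫ y in a..b, energyDensity u p y ≤ energy u := by
    rw [h.energy_eq, intervalIntegral.integral_of_le (le_trans ha hb)]
    exact setIntegral_le_integral hI (Eventually.of_forall (energyDensity_nonneg u p))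
  rw [← intervalIntegral.integral_add_adjacent_intervals (hI.intervalIntegrable (a := a) (b := x))
    (hI.intervalIntegrable (a := x) (b := b))] at h7
  have h8 := le_abs_self (modica ε (‖u b‖ ^ 2) - modica ε (‖u x‖ ^ 2))
  have h9 := neg_abs_le (modica ε (‖u x‖ ^ 2) - modica ε (‖u a‖ ^ 2))
  have h10 : √2 * (κ / √2) = κ := by field_simp
  have h11 : √2 / 2 * (2 * (modica ε 1 - κ / √2 - modica ε (‖u x‖ ^ 2))) ≤
      √2 / 2 * (|modica ε (‖u b‖ ^ 2) - modica ε (‖u x‖ ^ 2)| +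
        |modica ε (‖u x‖ ^ 2) - modica ε (‖u a‖ ^ 2)|) := by
    apply mul_le_mul_of_nonneg_left _ (by positivity)
    linarith [hclose a ha', hclose b hb']
  nlinarith

lemma modica_mono {ε y z : ℝ} (hy : 0 ≤ y) (hε : 0 < ε) (hyz : y ≤ z) (hz : z ≤ 1) :
    modica ε y ≤ modica ε z := by
  have h0 : √(y + ε) ≤ √(z + ε) := Real.sqrt_le_sqrt (by linarith)
  have h1 : √(z + ε) ^ 2 = z + ε := Real.sq_sqrt (by linarith)
  have h2 : √(y + ε) ^ 2 = y + ε := Real.sq_sqrt (by linarith)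
  have h3 := Real.sqrt_nonneg (y + ε)
  unfold modica
  have h4 : √(y + ε) * √(z + ε) ≤ √(z + ε) ^ 2 := by nlinarith
  have h5 : 0 ≤ (√(z + ε) - √(y + ε)) *
      ((1 + ε) - (√(z + ε) ^ 2 + √(y + ε) * √(z + ε) + √(y + ε) ^ 2) / 3) := by
    apply mul_nonneg
    · linarith
    · linarith
  nlinarith

/-- Below the energy `2√2/3` of the black soliton, the modulus is bounded from below. -/
theorem exists_lower_bound {E₀ : ℝ} (hE₀ : E₀ < 2 * √2 / 3) :
    ∃ m : ℝ, 0 < m ∧ ∀ u p q r : ℝ → ℂ, IsJet u p q r → energy u ≤ E₀ →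
      ∀ x, m ≤ ‖u x‖ ^ 2 := by
  have hc : Continuous (fun ε : ℝ => √2 * (modica ε 1 - modica ε ε)) := by
    unfold modica
    fun_prop
  -- At ε = 0 the cost of reaching a zero is exactly the energy of the black soliton, so a small ε >
  -- 0 still beats E₀.
  have h0 : √2 * (modica 0 1 - modica 0 0) = 2 * √2 / 3 := by
    simp [modica]
    ring
  have h1 : ∀ᶠ ε in 𝓝[>] (0 : ℝ), E₀ < √2 * (modica ε 1 - modica ε ε) := by
    apply eventually_nhdsWithin_of_eventually_nhds
    apply hc.continuousAt.eventually_const_lt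
    show E₀ < √2 * (modica 0 1 - modica 0 0)
    rwa [h0]
  obtain ⟨ε, hε1, hε2⟩ := (h1.and (Ioo_mem_nhdsGT (show (0 : ℝ) < 1 by norm_num))).exists
  -- The same ε serves as regularization and as lower bound: |u(x)|² < ε would force an energy above
  -- E₀.
  refine ⟨ε, hε2.1, fun u p q r h hE x => ?_⟩
  by_contra! hlt
  have h2 := h.modica_sub_le_energy hε2.1 x
  have h3 := modica_mono (sq_nonneg ‖u x‖) hε2.1 hlt.le hε2.2.le
  have h4 : 0 < √2 := by positivity
  nlinarith

/-! ### The hydrodynamic variables -/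

/-- Near x, continuity keeps |φ(y) - φ(x)| below π, so φ(y) = φ(x) + Im log(u(y)/u(x)) with the
principal logarithm, which is differentiable at 1. -/
lemma IsPhase.hasDerivAt {φ : ℝ → ℝ} {u : ℝ → ℂ} (h : IsPhase φ u) {u' : ℂ} {x : ℝ}
    (hd : HasDerivAt u u' x) (hx : u x ≠ 0) : HasDerivAt φ (u' / u x).im x := by
  have h1 : HasDerivAt (fun y => Complex.log (u y / u x)) (u' / u x) x := by
    have h2 := (hd.div_const (u x)).clog_real (by rw [div_self hx]; exact Complex.one_mem_slitPlane)
    rwa [div_self hx, div_one] at h2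
  have h3 : HasDerivAt (fun y => φ x + (Complex.log (u y / u x)).im) (u' / u x).im x :=
    (Complex.imCLM.hasFDerivAt.comp_hasDerivAt x h1).const_add _
  refine h3.congr_of_eventuallyEq ?_
  have h4 : ∀ᶠ y in 𝓝 x, dist (φ y) (φ x) < Real.pi :=
    h.1.continuousAt.eventually (Metric.ball_mem_nhds _ Real.pi_pos)
  have h5 : ∀ᶠ y in 𝓝 x, u y ≠ 0 := hd.continuousAt.eventually_ne hx
  filter_upwards [h4, h5] with y hy hy0
  have h6 : u y / u x = ((‖u y‖ / ‖u x‖ : ℝ) : ℂ) *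
      (Complex.cos ((φ y - φ x : ℝ) : ℂ) + Complex.sin ((φ y - φ x : ℝ) : ℂ) * Complex.I) := by
    rw [← Complex.exp_mul_I, div_eq_iff hx]
    conv_lhs => rw [h.2 y]
    conv_rhs => rw [h.2 x]
    have hnx : ((‖u x‖ : ℝ) : ℂ) ≠ 0 := by simpa using hx
    have h7 : Complex.exp (Complex.I * (φ y : ℂ)) =
        Complex.exp (((φ y - φ x : ℝ) : ℂ) * Complex.I) * Complex.exp (Complex.I * (φ x : ℂ)) := by
      rw [← Complex.exp_add]
      push_cast
      ring_nf
    rw [h7]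
    simp only [norm_mul, Complex.norm_real, norm_norm]
    push_cast
    have h8 : ‖Complex.exp (Complex.I * (φ x : ℂ))‖ = 1 := by
      rw [mul_comm, Complex.norm_exp_ofReal_mul_I]
    rw [h8]
    field_simp
    simp
  rw [Real.dist_eq, abs_lt] at hy
  rw [h6, Complex.log_im, Complex.arg_mul_cos_add_sin_mul_I
    (div_pos (norm_pos_iff.2 hy0) (norm_pos_iff.2 hx)) ⟨by linarith, by linarith⟩]
  ring

lemma ne_zero_of_le_normSq {m : ℝ} (hm : 0 < m) {z : ℂ} (h : m ≤ ‖z‖ ^ 2) : z ≠ 0 := by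
  rintro rfl
  simp at h
  linarith

lemma re_div_eq (a z : ℂ) : (a / z).re = inner ℝ z a / ‖z‖ ^ 2 := by
  rw [Complex.div_re, ← Complex.normSq_eq_norm_sq, Complex.inner]
  simp only [Complex.mul_re, Complex.conj_re, Complex.conj_im]
  ring

lemma inner_I_mul_eq {a z : ℂ} (hz : z ≠ 0) :
    inner ℝ (Complex.I * z) a = ‖z‖ ^ 2 * (a / z).im := by
  have h2 : Complex.normSq z ≠ 0 := by simpa using hz
  rw [← Complex.normSq_eq_norm_sq, Complex.div_im, Complex.inner]
  simp only [Complex.mul_re, Complex.mul_im, Complex.conj_re, Complex.conj_im, Complex.I_re,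
    Complex.I_im]
  field_simp
  ring

/-- This is the phase equation: the left side plays the role of ∂ₜφ, and its derivative in x is
∂ₜ∂ₓφ. -/
lemma im_velocity_div {u q : ℝ → ℂ} {x : ℝ} (hx : u x ≠ 0) :
    (velocity u q x / u x).im = eta u x + inner ℝ (u x) (q x) / ‖u x‖ ^ 2 := by
  have h1 : velocity u q x / u x = Complex.I * (q x / u x + ((eta u x : ℝ) : ℂ)) := by
    rw [velocity, eta]
    field_simp
  rw [h1, ← re_div_eq]
  simp
  ring

/-- The scalars stand for e = η, d = ∂ₓη, k = ∂ₓ²η, v = ∂ₓφ, R = ⟨u, ∂ₓ²u⟩/|u|², α = 1/m, β = 1/m².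
The 3 collects v² from 2|ev| ≤ e² + v² and 2v² from |cR| ≤ 2|R|. -/
lemma abs_quadratic_flux_le {e d k v R c α β : ℝ} (hα : 0 ≤ α) (hβ : 0 ≤ β) (hc : c ^ 2 = 2)
    (hR : |R| ≤ |k| * α / 2 + (d ^ 2 * β / 4 + v ^ 2)) :
    |-(2 * (e * v)) - c * R| ≤ (3 + α + β) * (|k| + (e ^ 2 + d ^ 2) + v ^ 2) := by
  have hc2 : |c| ≤ 2 := abs_le_of_sq_le_sq (by linarith) (by norm_num)
  have b4 : |c * R| ≤ 2 * |R| := by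
    rw [abs_mul]
    exact mul_le_mul_of_nonneg_right hc2 (abs_nonneg _)
  have b5 : |-(2 * (e * v))| ≤ e ^ 2 + v ^ 2 := by
    rw [abs_neg, abs_le]
    constructor <;> linarith [sq_nonneg (e - v), sq_nonneg (e + v), sub_sq e v, add_sq e v]
  have hk := abs_nonneg k
  have k1 : |k| * α ≤ α * (|k| + (e ^ 2 + d ^ 2) + v ^ 2) := by
    rw [mul_comm]
    exact mul_le_mul_of_nonneg_left (by linarith [sq_nonneg e, sq_nonneg d, sq_nonneg v]) hα
  have k2 : d ^ 2 * β ≤ β * (|k| + (e ^ 2 + d ^ 2) + v ^ 2) := by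
    rw [mul_comm]
    exact mul_le_mul_of_nonneg_left (by linarith [sq_nonneg e, sq_nonneg d, sq_nonneg v]) hβ
  have k3 : 0 ≤ d ^ 2 * β := by positivity
  refine (abs_sub _ _).trans ?_
  linarith [sq_nonneg e, sq_nonneg d, sq_nonneg v]

/-- For a = ∂ₓu and z = u, the two squares are those of ∂ₓ|u|/|u| and ∂ₓφ. -/
lemma normSq_div_eq (a z : ℂ) :
    ‖a‖ ^ 2 / ‖z‖ ^ 2 = (inner ℝ z a / ‖z‖ ^ 2) ^ 2 + (a / z).im ^ 2 := by
  have h1 : ‖a‖ ^ 2 / ‖z‖ ^ 2 = ‖a / z‖ ^ 2 := by rw [norm_div, div_pow]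
  rw [h1, ← re_div_eq, ← Complex.normSq_eq_norm_sq, Complex.normSq_apply]
  ring

/-! ### The flux of the Riemann invariants. -/

namespace IsJet

variable {u p q r : ℝ → ℂ}

lemma hasDerivAt_deriv_eta (h : IsJet u p q r) (x : ℝ) :
    HasDerivAt (deriv (eta u)) (-(2 * (inner ℝ (u x) (q x) + ‖p x‖ ^ 2))) x := by
  have h1 : deriv (eta u) = fun x => -(2 * inner ℝ (u x) (p x)) :=
    funext fun x => (h.hasDerivAt_eta x).deriv
  rw [h1]
  have h2 := (((h.hasDerivAt_zero x).inner ℝ (h.hasDerivAt_one x)).const_mul 2).neg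
  rw [real_inner_self_eq_norm_sq] at h2
  exact h2

lemma iteratedDeriv_two_eta (h : IsJet u p q r) (x : ℝ) :
    iteratedDeriv 2 (eta u) x = -(2 * (inner ℝ (u x) (q x) + ‖p x‖ ^ 2)) := by
  rw [iteratedDeriv_succ, iteratedDeriv_one]
  exact (h.hasDerivAt_deriv_eta x).deriv

lemma continuous_eta (h : IsJet u p q r) : Continuous (eta u) :=
  continuous_const.sub (h.continuous_zero.norm.pow 2)

lemma continuous_deriv_eta (h : IsJet u p q r) : Continuous (deriv (eta u)) :=
  continuous_iff_continuousAt.2 fun x => (h.hasDerivAt_deriv_eta x).continuousAt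

lemma continuous_iteratedDeriv_eta (h : IsJet u p q r) :
    Continuous (iteratedDeriv 2 (eta u)) := by
  rw [funext h.iteratedDeriv_two_eta]
  exact (continuous_const.mul ((h.continuous_zero.inner h.continuous_two).add
    (h.continuous_one.norm.pow 2))).neg

/-- The flux of the Riemann invariant `η - c ∂ₓφ` along its characteristic is at least quadratic,
up to the dispersive term. -/
lemma abs_flux_le (h : IsJet u p q r) {m c : ℝ} (hm : 0 < m) (hu : ∀ x, m ≤ ‖u x‖ ^ 2)
    (hc : c ^ 2 = 2) (x : ℝ) :
    |(2 * inner ℝ (Complex.I * u x) (p x) - c * (velocity u q x / u x).im) +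
        c * (eta u x - c * (p x / u x).im)| ≤
      (3 + 1 / m + 1 / m ^ 2) * (|iteratedDeriv 2 (eta u) x| +
        (|eta u x| ^ 2 + |deriv (eta u) x| ^ 2) + |(p x / u x).im| ^ 2) := by
  have hx := ne_zero_of_le_normSq hm (hu x)
  have hp : 0 < ‖u x‖ ^ 2 := hm.trans_le (hu x)
  have e3 : deriv (eta u) x = -(2 * inner ℝ (u x) (p x)) := (h.hasDerivAt_eta x).deriv
  have e4 := h.iteratedDeriv_two_eta x
  have e5 := normSq_div_eq (p x) (u x)
  -- From ∂ₓ²η = -2(⟨u, ∂ₓ²u⟩ + |∂ₓu|²): the only term that is not quadratic is the dispersive one,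
  -- in ∂ₓ²η.
  have e6 : inner ℝ (u x) (q x) / ‖u x‖ ^ 2 =
      -(iteratedDeriv 2 (eta u) x / (2 * ‖u x‖ ^ 2)) - ‖p x‖ ^ 2 / ‖u x‖ ^ 2 := by
    rw [e4]
    field_simp
    ring
  have e7 : inner ℝ (u x) (p x) / ‖u x‖ ^ 2 = -(deriv (eta u) x / (2 * ‖u x‖ ^ 2)) := by
    rw [e3]
    field_simp
  -- The linear terms cancel: -cη against cη, and 2∂ₓφ against c²∂ₓφ, the latter because c² = 2.
  have e8 : (2 * inner ℝ (Complex.I * u x) (p x) - c * (velocity u q x / u x).im) +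
      c * (eta u x - c * (p x / u x).im) =
      -(2 * (eta u x * (p x / u x).im)) - c * (inner ℝ (u x) (q x) / ‖u x‖ ^ 2) := by
    rw [inner_I_mul_eq hx, im_velocity_div hx]
    unfold eta
    linear_combination -(p x / u x).im * hc
  have b1 : |iteratedDeriv 2 (eta u) x / (2 * ‖u x‖ ^ 2)| ≤
      |iteratedDeriv 2 (eta u) x| * (1 / m) / 2 := by
    rw [abs_div, abs_of_pos (show 0 < 2 * ‖u x‖ ^ 2 by positivity), mul_one_div, div_div,
      mul_comm m 2]
    gcongr
    exact hu x
  have b2 : (inner ℝ (u x) (p x) / ‖u x‖ ^ 2) ^ 2 ≤ deriv (eta u) x ^ 2 * (1 / m ^ 2) / 4 := by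
    rw [e7, neg_sq, div_pow, mul_one_div, div_div, mul_pow, mul_comm (m ^ 2)]
    norm_num
    gcongr
    exact hu x
  rw [e8]
  simp only [sq_abs]
  refine abs_quadratic_flux_le (by positivity) (by positivity) hc ?_
  rw [e6, e5]
  refine (abs_sub _ _).trans (add_le_add (by rwa [abs_neg]) ?_)
  rw [abs_of_nonneg (by positivity)]
  linarith

end IsJet

namespace IsJetCurve

variable {A : ℝ} {Ψ p q r : ℝ → ℝ → ℂ}

/-- The balance law for the Riemann invariant `η - c ∂ₓφ` on a window moving at speed `c`. -/
lemma integral_riemann_sub (h : IsJetCurve A Ψ p q r) (hs : SolvesGP Ψ)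
    (h0 : ∀ t x, Ψ t x ≠ 0) (c a b t : ℝ) :
    (∫ x in (a + c * t)..(b + c * t), (eta (Ψ t) x - c * (p t x / Ψ t x).im)) -
        ∫ x in a..b, (eta (Ψ 0) x - c * (p 0 x / Ψ 0 x).im) =
      ∫ s in (0 : ℝ)..t,
        (((2 * inner ℝ (Complex.I * Ψ s (b + c * s)) (p s (b + c * s)) -
            c * (velocity (Ψ s) (q s) (b + c * s) / Ψ s (b + c * s)).im) +
          c * (eta (Ψ s) (b + c * s) - c * (p s (b + c * s) / Ψ s (b + c * s)).im)) -
        ((2 * inner ℝ (Complex.I * Ψ s (a + c * s)) (p s (a + c * s)) -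
            c * (velocity (Ψ s) (q s) (a + c * s) / Ψ s (a + c * s)).im) +
          c * (eta (Ψ s) (a + c * s) - c * (p s (a + c * s) / Ψ s (a + c * s)).im))) := by
  have c0 := h.continuous_zero
  have c1 := h.continuous_one
  have c2 := h.continuous_two
  have cv := h.continuous_velocity
  have cvd := h.continuous_velocityDeriv
  have cη : Continuous (fun z : ℝ × ℝ => eta (Ψ z.1) z.2) := continuous_const.sub (c0.norm.pow 2)
  have him : ∀ {f : ℝ → ℂ} {f' : ℂ} {x : ℝ}, HasDerivAt f f' x →
      HasDerivAt (fun x => (f x).im) f'.im x := fun hf =>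
    Complex.imCLM.hasFDerivAt.comp_hasDerivAt _ hf
  have cI : Continuous (fun z : ℝ × ℝ => Complex.I * Ψ z.1 z.2) := continuous_const.mul c0
  -- ∂ₓφ is written Im(∂ₓΨ/Ψ), since the phases at different times are unrelated and φ need not be
  -- regular in t.
  refine integral_window_sub (w := fun t x => eta (Ψ t) x - c * (p t x / Ψ t x).im)
    (wx := fun t x => -(2 * inner ℝ (Ψ t x) (p t x)) -
      c * ((q t x * Ψ t x - p t x * p t x) / Ψ t x ^ 2).im)
    (J := fun t x => 2 * inner ℝ (Complex.I * Ψ t x) (p t x) -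
      c * (velocity (Ψ t) (q t) x / Ψ t x).im)
    (Jx := fun t x => 2 * (inner ℝ (Complex.I * Ψ t x) (q t x) +
        inner ℝ (Complex.I * p t x) (p t x)) -
      c * ((velocityDeriv (Ψ t) (p t) (r t) x * Ψ t x - velocity (Ψ t) (q t) x * p t x) /
        Ψ t x ^ 2).im) ?_ ?_ ?_ ?_ ?_ ?_ ?_ c a b t
  · intro t x
    have e1 := (h.hasDerivAt_time hs t x).norm_sq.const_sub 1
    have e2 := (him ((h.hasDerivAt_time_one hs t x).div (h.hasDerivAt_time hs t x)
      (h0 t x))).const_mul c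
    refine (e1.sub e2).congr_deriv ?_
    rw [mul_comm (p t x) (velocity _ _ _)]
    congr 1
    simp only [velocity, Complex.inner, Complex.mul_re, Complex.mul_im, Complex.add_re,
      Complex.add_im, Complex.conj_re, Complex.conj_im, Complex.ofReal_re, Complex.ofReal_im,
      Complex.I_re, Complex.I_im]
    ring
  · intro t x
    exact ((h.isJet t).hasDerivAt_eta x).sub ((him (((h.isJet t).hasDerivAt_one x).div
      ((h.isJet t).hasDerivAt_zero x) (h0 t x))).const_mul c)
  · intro t x
    exact (((((h.isJet t).hasDerivAt_zero x).const_mul Complex.I).inner ℝ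
      ((h.isJet t).hasDerivAt_one x)).const_mul 2).sub
      ((him (((h.isJet t).hasDerivAt_velocity x).div
      ((h.isJet t).hasDerivAt_zero x) (h0 t x))).const_mul c)
  · exact cη.sub (continuous_const.mul (Complex.continuous_im.comp (c1.div c0 fun z => h0 _ _)))
  · exact (continuous_const.mul (c0.inner c1)).neg.sub (continuous_const.mul
      (Complex.continuous_im.comp (((c2.mul c0).sub (c1.mul c1)).div (c0.pow 2)
        fun z => pow_ne_zero 2 (h0 _ _))))
  · exact (continuous_const.mul (cI.inner c1)).sub
      (continuous_const.mul (Complex.continuous_im.comp (cv.div c0 fun z => h0 _ _)))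
  · exact (continuous_const.mul ((cI.inner c2).add ((continuous_const.mul c1).inner c1))).sub
      (continuous_const.mul (Complex.continuous_im.comp (((cvd.mul c0).sub (cv.mul c1)).div
        (c0.pow 2) fun z => pow_ne_zero 2 (h0 _ _))))

end IsJetCurve

/-! ### The estimate -/

lemma enorm_le_normLinf {f : ℝ → ℝ} (hf : Continuous f) (x : ℝ) : ‖f x‖ₑ ≤ normLinf f := by
  have := enorm_le_eLpNorm_top_of_isOpen hf isOpen_univ (Set.mem_univ x)
  rwa [Measure.restrict_univ] at this

lemma normLinf_le {f : ℝ → ℝ} {M : ℝ} (h : ∀ x, |f x| ≤ M) : normLinf f ≤ ENNReal.ofReal M := by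
  unfold normLinf
  rw [eLpNorm_exponent_top]
  exact eLpNormEssSup_le_of_ae_bound (Eventually.of_forall h)

lemma enorm_intervalIntegral_le (f : ℝ → ℝ) (a b : ℝ) :
    ‖∫ x in a..b, f x‖ₑ ≤ ∫⁻ x in Set.uIcc a b, ‖f x‖ₑ := by
  rw [← ofReal_norm, intervalIntegral.norm_intervalIntegral_eq, ofReal_norm]
  exact (enorm_integral_le_lintegral_enorm _).trans (lintegral_mono_set Set.uIoc_subset_uIcc)

lemma enorm_integral_le_normM (f : ℝ → ℝ) (a b : ℝ) : ‖∫ x in a..b, f x‖ₑ ≤ normM f :=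
  le_iSup₂ (f := fun a b => ‖∫ x in a..b, f x‖ₑ) a b

/-- The integrand of `transportIntegral`. -/
noncomputable def transportDensity (u : ℝ → ℂ) (φ : ℝ → ℝ) : ℝ≥0∞ :=
  normLinf (iteratedDeriv 2 (eta u)) + normW2inf (eta u) ^ 2 + normLinf (deriv φ) ^ 2

namespace IsJet

variable {u p q r : ℝ → ℂ} {φ : ℝ → ℝ}

lemma deriv_phase (h : IsJet u p q r) (hφ : IsPhase φ u) (hu : ∀ x, u x ≠ 0) :
    deriv φ = fun x => (p x / u x).im :=
  funext fun x => (hφ.hasDerivAt (h.hasDerivAt_zero x) (hu x)).deriv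

lemma continuous_im_div (h : IsJet u p q r) (hu : ∀ x, u x ≠ 0) :
    Continuous (fun x => (p x / u x).im) :=
  Complex.continuous_im.comp (h.continuous_one.div h.continuous_zero hu)

lemma enorm_flux_le (h : IsJet u p q r) (hφ : IsPhase φ u) {m c : ℝ} (hm : 0 < m)
    (hu : ∀ x, m ≤ ‖u x‖ ^ 2) (hc : c ^ 2 = 2) (x : ℝ) :
    ‖(2 * inner ℝ (Complex.I * u x) (p x) - c * (velocity u q x / u x).im) +
        c * (eta u x - c * (p x / u x).im)‖ₑ ≤
      ENNReal.ofReal (3 + 1 / m + 1 / m ^ 2) * transportDensity u φ := by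
  have hu0 : ∀ x, u x ≠ 0 := fun x => ne_zero_of_le_normSq hm (hu x)
  rw [Real.enorm_eq_ofReal_abs]
  refine (ENNReal.ofReal_le_ofReal (h.abs_flux_le hm hu hc x)).trans ?_
  rw [ENNReal.ofReal_mul (by positivity)]
  gcongr
  rw [ENNReal.ofReal_add (by positivity) (by positivity), ENNReal.ofReal_add (by positivity)
    (by positivity), ENNReal.ofReal_add (by positivity) (by positivity),
    ENNReal.ofReal_pow (abs_nonneg _), ENNReal.ofReal_pow (abs_nonneg _),
    ENNReal.ofReal_pow (abs_nonneg _)]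
  simp only [← Real.enorm_eq_ofReal_abs]
  unfold transportDensity normW2inf
  have h0 := enorm_le_normLinf h.continuous_eta x
  have h1 := enorm_le_normLinf h.continuous_deriv_eta x
  have h2 := enorm_le_normLinf h.continuous_iteratedDeriv_eta x
  have h3 := enorm_le_normLinf (h.continuous_im_div hu0) x
  rw [h.deriv_phase hφ hu0]
  refine add_le_add (add_le_add h2 ?_) (pow_le_pow_left' h3 2)
  calc ‖eta u x‖ₑ ^ 2 + ‖deriv (eta u) x‖ₑ ^ 2
      ≤ normLinf (eta u) ^ 2 + normLinf (deriv (eta u)) ^ 2 :=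
        add_le_add (pow_le_pow_left' h0 2) (pow_le_pow_left' h1 2)
    _ ≤ (normLinf (eta u) + normLinf (deriv (eta u))) ^ 2 := by
        rw [add_sq, add_right_comm]
        exact le_self_add
    _ ≤ _ := pow_le_pow_left' le_self_add 2

lemma transportDensity_le (h : IsJet u p q r) (hφ : IsPhase φ u) {m M : ℝ} (hm : 0 < m)
    (hu : ∀ x, m ≤ ‖u x‖ ^ 2) (hM : ∀ x, ‖u x‖ ≤ M ∧ ‖p x‖ ≤ M ∧ ‖q x‖ ≤ M) :
    transportDensity u φ ≤ ENNReal.ofReal (4 * M ^ 2) +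
      (ENNReal.ofReal (1 + M ^ 2) + ENNReal.ofReal (2 * M ^ 2) + ENNReal.ofReal (4 * M ^ 2)) ^ 2 +
      ENNReal.ofReal (1 + M ^ 2 / m) ^ 2 := by
  have hu0 : ∀ x, u x ≠ 0 := fun x => ne_zero_of_le_normSq hm (hu x)
  have hM0 : 0 ≤ M := (norm_nonneg _).trans (hM 0).1
  have inner_le : ∀ {a b : ℂ}, ‖a‖ ≤ M → ‖b‖ ≤ M → |inner ℝ a b| ≤ M ^ 2 := fun ha hb =>
    (abs_real_inner_le_norm _ _).trans (by
      rw [sq]; exact mul_le_mul ha hb (norm_nonneg _) hM0)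
  have h0 : normLinf (eta u) ≤ ENNReal.ofReal (1 + M ^ 2) := normLinf_le fun x => by
    have := (hM x).1
    unfold eta
    rw [abs_le]
    constructor <;> nlinarith [norm_nonneg (u x)]
  have h1 : normLinf (deriv (eta u)) ≤ ENNReal.ofReal (2 * M ^ 2) := normLinf_le fun x => by
    rw [(h.hasDerivAt_eta x).deriv, abs_neg, abs_mul, abs_two]
    linarith [inner_le (hM x).1 (hM x).2.1]
  have h2 : normLinf (iteratedDeriv 2 (eta u)) ≤ ENNReal.ofReal (4 * M ^ 2) :=
    normLinf_le fun x => by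
      rw [h.iteratedDeriv_two_eta x, abs_neg, abs_mul, abs_two]
      have h3 := abs_add_le (inner ℝ (u x) (q x)) (‖p x‖ ^ 2)
      rw [abs_of_nonneg (sq_nonneg ‖p x‖)] at h3
      have h4 := pow_le_pow_left₀ (norm_nonneg _) (hM x).2.1 2
      linarith [inner_le (hM x).1 (hM x).2.2]
  have h3 : normLinf (deriv φ) ≤ ENNReal.ofReal (1 + M ^ 2 / m) := normLinf_le fun x => by
    rw [h.deriv_phase hφ hu0]
    have h4 := normSq_div_eq (p x) (u x)
    have h5 : ‖p x‖ ^ 2 / ‖u x‖ ^ 2 ≤ M ^ 2 / m := by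
      have := pow_le_pow_left₀ (norm_nonneg _) (hM x).2.1 2
      gcongr
      exact hu x
    have h6 := sq_abs (p x / u x).im
    nlinarith [sq_nonneg (inner ℝ (u x) (p x) / ‖u x‖ ^ 2), abs_nonneg (p x / u x).im,
      sq_nonneg (|(p x / u x).im| - 1)]
  unfold transportDensity normW2inf
  gcongr

end IsJet

namespace IsJetCurve

variable {A : ℝ} {Ψ p q r : ℝ → ℝ → ℂ} {φ : ℝ → ℝ → ℝ}

lemma transportIntegral_lt_top (h : IsJetCurve A Ψ p q r) (hφ : ∀ t, IsPhase (φ t) (Ψ t)) {m : ℝ}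
    (hm : 0 < m) (hu : ∀ t x, m ≤ ‖Ψ t x‖ ^ 2) (t : ℝ) : transportIntegral Ψ φ t < ⊤ := by
  obtain ⟨M, hM⟩ := h.exists_bound (isCompact_uIcc (a := 0) (b := t))
  refine (setLIntegral_mono' measurableSet_uIcc fun s hs =>
    (h.isJet s).transportDensity_le (hφ s) hm (hu s) (hM s hs)).trans_lt ?_
  rw [setLIntegral_const]
  refine ENNReal.mul_lt_top ?_ isCompact_uIcc.measure_lt_top
  simp only [ENNReal.add_lt_top, ENNReal.ofReal_lt_top, ENNReal.pow_lt_top_iff, and_true,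
    true_or]

lemma enorm_integral_riemann_le (h : IsJetCurve A Ψ p q r) (hs : SolvesGP Ψ)
    (hφ : ∀ t, IsPhase (φ t) (Ψ t)) {m c : ℝ} (hm : 0 < m) (hu : ∀ t x, m ≤ ‖Ψ t x‖ ^ 2)
    (hc : c ^ 2 = 2) (a b t : ℝ) :
    ‖∫ x in a..b, (eta (Ψ t) x - c * deriv (φ t) x)‖ₑ ≤
      normM (eta (Ψ 0)) + ENNReal.ofReal √2 * normM (deriv (φ 0)) +
        2 * ENNReal.ofReal (3 + 1 / m + 1 / m ^ 2) * transportIntegral Ψ φ t := by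
  have h0 : ∀ t x, Ψ t x ≠ 0 := fun t x => ne_zero_of_le_normSq hm (hu t x)
  -- The window starts at [a - ct, b - ct], so that it arrives at [a, b] at time t.
  have key := h.integral_riemann_sub hs h0 c (a - c * t) (b - c * t) t
  rw [sub_add_cancel, sub_add_cancel, sub_eq_iff_eq_add'] at key
  have hd : ∀ s, deriv (φ s) = fun x => (p s x / Ψ s x).im := fun s =>
    (h.isJet s).deriv_phase (hφ s) (h0 s)
  rw [hd t, key]
  refine (enorm_add_le _ _).trans (add_le_add ?_ ?_)
  · have i1 : ∀ a b, IntervalIntegrable (eta (Ψ 0)) volume a b :=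
      (h.isJet 0).continuous_eta.intervalIntegrable
    have i2 : ∀ a b, IntervalIntegrable (fun x => c * (p 0 x / Ψ 0 x).im) volume a b :=
      (continuous_const.mul ((h.isJet 0).continuous_im_div (h0 0))).intervalIntegrable
    rw [intervalIntegral.integral_sub (i1 _ _) (i2 _ _), intervalIntegral.integral_const_mul]
    refine enorm_sub_le.trans (add_le_add (enorm_integral_le_normM _ _ _) ?_)
    have hc' : |c| = √2 := by rw [← hc, Real.sqrt_sq_eq_abs]
    rw [enorm_mul, Real.enorm_eq_ofReal_abs, hc', hd 0]
    gcongr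
    exact enorm_integral_le_normM _ _ _
  · refine (enorm_intervalIntegral_le _ _ _).trans ?_
    unfold transportIntegral
    rw [← lintegral_const_mul' _ _ (ENNReal.mul_ne_top (by simp) ENNReal.ofReal_ne_top)]
    refine lintegral_mono fun s => ?_
    refine enorm_sub_le.trans ?_
    -- One flux bound for each end of the window.
    rw [mul_assoc, two_mul (ENNReal.ofReal _ * _)]
    exact add_le_add ((h.isJet s).enorm_flux_le (hφ s) hm (hu s) hc _)
      ((h.isJet s).enorm_flux_le (hφ s) hm (hu s) hc _)

lemma normM_le (h : IsJetCurve A Ψ p q r) (hs : SolvesGP Ψ)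
    (hφ : ∀ t, IsPhase (φ t) (Ψ t)) {m : ℝ} (hm : 0 < m) (hu : ∀ t x, m ≤ ‖Ψ t x‖ ^ 2) (t : ℝ) :
    normM (eta (Ψ t)) + ENNReal.ofReal √2 * normM (deriv (φ t)) ≤
      4 * (normM (eta (Ψ 0)) + ENNReal.ofReal √2 * normM (deriv (φ 0)) +
        2 * ENNReal.ofReal (3 + 1 / m + 1 / m ^ 2) * transportIntegral Ψ φ t) := by
  have h0 : ∀ t x, Ψ t x ≠ 0 := fun t x => ne_zero_of_le_normSq hm (hu t x)
  have hsq : (√2) ^ 2 = 2 := Real.sq_sqrt (by norm_num)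
  set B := normM (eta (Ψ 0)) + ENNReal.ofReal √2 * normM (deriv (φ 0)) +
        2 * ENNReal.ofReal (3 + 1 / m + 1 / m ^ 2) * transportIntegral Ψ φ t with hB
  have i1 : ∀ a b, IntervalIntegrable (eta (Ψ t)) volume a b :=
    (h.isJet t).continuous_eta.intervalIntegrable
  have i2 : ∀ (c a b : ℝ), IntervalIntegrable (fun x => c * deriv (φ t) x) volume a b := by
    intro c
    rw [(h.isJet t).deriv_phase (hφ t) (h0 t)]
    exact (continuous_const.mul ((h.isJet t).continuous_im_div (h0 t))).intervalIntegrable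
  have hw : ∀ a b : ℝ, ‖(∫ x in a..b, eta (Ψ t) x) - √2 * ∫ x in a..b, deriv (φ t) x‖ₑ ≤ B ∧
      ‖(∫ x in a..b, eta (Ψ t) x) - (-√2) * ∫ x in a..b, deriv (φ t) x‖ₑ ≤ B := by
    intro a b
    have k1 := h.enorm_integral_riemann_le hs hφ hm hu hsq a b t
    have k2 := h.enorm_integral_riemann_le hs hφ hm hu (c := -√2) (by rw [neg_sq, hsq]) a b t
    rw [intervalIntegral.integral_sub (i1 _ _) (i2 _ _ _),
      intervalIntegral.integral_const_mul] at k1 k2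
    exact ⟨k1, k2⟩
  -- ∫η and √2∫∂ₓφ are the half-sum and half-difference of the integrals of the two invariants. The
  -- factor ½ is dropped, so each norm is at most 2B and their sum at most 4B.
  have half : ∀ {x y z : ℝ}, 2 * z = x + y → ‖x‖ₑ ≤ B → ‖y‖ₑ ≤ B → ‖z‖ₑ ≤ 2 * B := by
    intro x y z hz hx hy
    have h1 : ‖z‖ₑ ≤ ‖x + y‖ₑ := by
      rw [← hz, Real.enorm_eq_ofReal_abs, Real.enorm_eq_ofReal_abs, abs_mul, abs_two]
      exact ENNReal.ofReal_le_ofReal (by linarith [abs_nonneg z])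
    rw [two_mul]
    exact h1.trans ((enorm_add_le _ _).trans (add_le_add hx hy))
  have e1 : normM (eta (Ψ t)) ≤ 2 * B := iSup₂_le fun a b =>
    half (by ring) (hw a b).1 (hw a b).2
  have e2 : ENNReal.ofReal √2 * normM (deriv (φ t)) ≤ 2 * B := by
    unfold normM
    rw [ENNReal.mul_iSup]
    refine iSup_le fun a => ?_
    rw [ENNReal.mul_iSup]
    refine iSup_le fun b => ?_
    have hn : ENNReal.ofReal √2 = ‖√2‖ₑ := by
      rw [Real.enorm_eq_ofReal_abs, abs_of_nonneg (Real.sqrt_nonneg _)]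
    rw [hn, ← enorm_mul]
    refine half (y := -((∫ x in a..b, eta (Ψ t) x) - √2 * ∫ x in a..b, deriv (φ t) x)) ?_
      (hw a b).2 (by rw [enorm_neg]; exact (hw a b).1)
    ring
  refine (add_le_add e1 e2).trans (le_of_eq ?_)
  ring

end IsJetCurve

end GrossPitaevskii

/-! ### Conclusion: choice of the constant. -/

open GrossPitaevskii
theorem mainTheorem8 (E₀ : ℝ) (hE₀_nonneg : 0 ≤ E₀) (hE₀ : E₀ < 2 * √2 / 3) :
    ∃ K : ℝ≥0, 0 < K ∧
      ∀ (A : ℝ) (_ : 0 < A) (Ψ : ℝ → ℝ → ℂ) (_ : MemC0X 4 A Ψ) (_ : SolvesGP Ψ)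
        (_ : energy (Ψ 0) ≤ E₀)
        (φ : ℝ → ℝ → ℝ) (_ : ∀ t, IsPhase (φ t) (Ψ t)) (t : ℝ),
        transportIntegral Ψ φ t < ⊤ ∧
          normM (eta (Ψ t)) + ENNReal.ofReal √2 * normM (deriv (φ t)) ≤
            K * (normM (eta (Ψ 0)) + ENNReal.ofReal √2 * normM (deriv (φ 0)) +
              transportIntegral Ψ φ t) := by
  obtain ⟨m, hm, hlow⟩ := exists_lower_bound hE₀
  set C := 3 + 1 / m + 1 / m ^ 2 with hC
  have hC0 : 1 ≤ 2 * C := by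
    have : 0 < 1 / m := by positivity
    have : 0 < 1 / m ^ 2 := by positivity
    linarith
  -- 4 comes from `normM_le` and 2C from the fluxes at the two ends; 2C ≥ 1 lets the same constant
  -- cover the initial norms. It depends on E₀ only, through m.
  refine ⟨4 * (2 * C).toNNReal, ?_, ?_⟩
  · have : 0 < (2 * C).toNNReal := Real.toNNReal_pos.2 (by linarith)
    positivity
  intro A hA Ψ hX hs hE φ hφ t
  obtain ⟨p, q, r, h⟩ := exists_isJetCurve hA hX
  -- Conservation of energy carries the initial bound, hence the absence of zeros, to all times.
  have hu : ∀ t x, m ≤ ‖Ψ t x‖ ^ 2 := fun t =>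
    hlow _ _ _ _ (h.isJet t) ((h.energy_eq hs t).le.trans hE)
  refine ⟨h.transportIntegral_lt_top hφ hm hu t, (h.normM_le hs hφ hm hu t).trans ?_⟩
  have hCe : 2 * ENNReal.ofReal C = ((2 * C).toNNReal : ℝ≥0∞) := by
    rw [← ENNReal.ofReal_ofNat 2, ← ENNReal.ofReal_mul (by norm_num)]
    rfl
  have hC1 : (1 : ℝ≥0∞) ≤ ((2 * C).toNNReal : ℝ≥0∞) := by
    rw [ENNReal.one_le_coe_iff, Real.one_le_toNNReal]
    exact hC0
  rw [hCe]
  push_cast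
  rw [mul_assoc, mul_add _ _ (transportIntegral Ψ φ t)]
  gcongr
  exact le_mul_of_one_le_left (by simp) hC1
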